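/- Let $R$ be a commutative ring with unity; $\otimes$ means $\otimes_R$. Let $C$ and $D$ be (coassociative, counital) $R$-coalgebras that are flat as $R$-modules. For a right $C$-comodule $(M,\varrho_M)$ and a left $C$-comodule $(N,\varrho_N)$ let $$M\,\square_C N=\ker\bigl(\varrho_M\otimes \mathrm{id}-\mathrm{id}\otimes\varrho_N : M\otimes N\to M\otimes C\otimes N\bigr).$$ If $M$ is a $D$-$C$-bicomodule (resp. $N$ is a $C$-$D$-bicomodule), $M\,\square_C N$ is a left (resp. right) $D$-subcomodule of $M\otimes N$. A submodule $W\subseteq V$ is pure if $W\otimes X\to V\otimes X$ is injective for every $R$-module $X$. $C$ and $D$ are called Morita–Takeuchi equivalent if the categories of right comodules $\mathcal M^C$ and $\mathcal M^D$ are equivalent as $R$-linear categories (i.e. by an additive $R$-linear equivalence). A Morita–Takeuchi context $(D,C,M,N,f,g)$ consists of a $D$-$C$-bicomodule $M$, a $C$-$D$-bicomodule $N$ and bicomodule morphisms $f:D\to M\,\square_C N$, $g:C\to N\,\square_D M$ such that 1. $M$ and $N$ are flat as $R$-modules; 2. $M\,\square_C N$ is pure in $M\otimes N$ and $N\,\square_D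 M$ is pure in $N\otimes M$; 3. under the canonical identifications $M\cong M\,\square_C C\cong D\,\square_D M$, $N\cong N\,\square_D D\cong C\,\square_C N$, $(M\,\square_C N)\,\square_D M\cong M\,\square_C (N\,\square_D M)$ and $(N\,\square_D M)\,\square_C N\cong N\,\square_D (M\,\square_C N)$, $$\mathrm{id}_M\,\square_C\, g=f\,\square_D\,\mathrm{id}_M \ \text{ on } M,\qquad \mathrm{id}_N\,\square_D\, f=g\,\square_C\,\mathrm{id}_N \ \text{ on } N.$$ It is called strict if $f$ and $g$ are bijective. **Theorem.** $C$ and $D$ are Morita–Takeuchi equivalent if and only if there exists a strict Morita–Takeuchi context $(D,C,M,N,f,g)$. -/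

import Mathlib

open scoped TensorProduct
open CategoryTheory

universe u v w x y z

namespace MoritaTakeuchi


/-! ### Comodules and bicomodules over a coalgebra -/

section Comodules

variable (R : Type u) [CommRing R] (C : Type v) [AddCommGroup C] [Module R C] [Coalgebra R C]

/-- A right `C`-comodule structure on the `R`-module `M`. -/
class RightComodule (M : Type w) [AddCommGroup M] [Module R M] where
  /-- the coaction `M → M ⊗ C` -/
  coact : M →ₗ[R] M ⊗[R] C
  coassoc : (TensorProduct.assoc R M C C).toLinearMap ∘ₗ coact.rTensor C ∘ₗ coact =
    (Coalgebra.comul (R := R) (A := C)).lTensor M ∘ₗ coact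
  counit_coact : (TensorProduct.rid R M).toLinearMap ∘ₗ
    (Coalgebra.counit (R := R) (A := C)).lTensor M ∘ₗ coact = LinearMap.id

/-- A left `C`-comodule structure on the `R`-module `M`. -/
class LeftComodule (M : Type w) [AddCommGroup M] [Module R M] where
  /-- the coaction `M → C ⊗ M` -/
  coact : M →ₗ[R] C ⊗[R] M
  coassoc : (TensorProduct.assoc R C C M).toLinearMap ∘ₗ
      (Coalgebra.comul (R := R) (A := C)).rTensor M ∘ₗ coact =
    coact.lTensor C ∘ₗ coact
  counit_coact : (TensorProduct.lid R M).toLinearMap ∘ₗ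
    (Coalgebra.counit (R := R) (A := C)).rTensor M ∘ₗ coact = LinearMap.id

/-- The right coaction `M → M ⊗ C`. -/
abbrev rcoact (M : Type w) [AddCommGroup M] [Module R M] [RightComodule R C M] :
    M →ₗ[R] M ⊗[R] C := RightComodule.coact

/-- The left coaction `M → C ⊗ M`. -/
abbrev lcoact (M : Type w) [AddCommGroup M] [Module R M] [LeftComodule R C M] :
    M →ₗ[R] C ⊗[R] M := LeftComodule.coact

/-- A left `C`-comodule and right `D`-comodule `M` is a `C`-`D`-bicomodule if its two coactions
commute. -/
class IsBicomodule (D : Type x) [AddCommGroup D] [Module R D] [Coalgebra R D]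
    (M : Type w) [AddCommGroup M] [Module R M] [LeftComodule R C M] [RightComodule R D M] :
    Prop where
  comm : (TensorProduct.assoc R C M D).toLinearMap ∘ₗ (lcoact R C M).rTensor D ∘ₗ rcoact R D M =
    (rcoact R D M).lTensor C ∘ₗ lcoact R C M

variable {M : Type w} [AddCommGroup M] [Module R M] {N : Type x} [AddCommGroup N] [Module R N]

/-- `C`-colinear maps of right `C`-comodules. -/
def IsRightColinear [RightComodule R C M] [RightComodule R C N] (f : M →ₗ[R] N) : Prop :=
  rcoact R C N ∘ₗ f = f.rTensor C ∘ₗ rcoact R C M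

/-- `C`-colinear maps of left `C`-comodules. -/
def IsLeftColinear [LeftComodule R C M] [LeftComodule R C N] (f : M →ₗ[R] N) : Prop :=
  lcoact R C N ∘ₗ f = f.lTensor C ∘ₗ lcoact R C M

/-- The coalgebra `C` as a right comodule over itself. -/
instance : RightComodule R C C where
  coact := Coalgebra.comul
  coassoc := Coalgebra.coassoc
  counit_coact := by
    rw [Coalgebra.lTensor_counit_comp_comul]; ext; simp

/-- The coalgebra `C` as a left comodule over itself. -/
instance : LeftComodule R C C where
  coact := Coalgebra.comul
  coassoc := Coalgebra.coassoc
  counit_coact := by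
    rw [Coalgebra.rTensor_counit_comp_comul]; ext; simp

instance : IsBicomodule R C C C where
  comm := Coalgebra.coassoc

end Comodules

/-! ### The category of right comodules -/

section Category

variable (R : Type u) [CommRing R] (C : Type u) [AddCommGroup C] [Module R C] [Coalgebra R C]

/-- The `R`-module `Com_C(M, N)` of colinear maps between right `C`-comodules. -/
def comHom (M N : Type u) [AddCommGroup M] [Module R M] [RightComodule R C M]
    [AddCommGroup N] [Module R N] [RightComodule R C N] : Submodule R (M →ₗ[R] N) where
  carrier := {f | IsRightColinear R C f}
  add_mem' {f g} hf hg := by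
    simp only [IsRightColinear, Set.mem_ofPred_eq] at *
    rw [LinearMap.comp_add, hf, hg, LinearMap.rTensor_add, LinearMap.add_comp]
  zero_mem' := by simp [IsRightColinear]
  smul_mem' r f hf := by
    simp only [IsRightColinear, Set.mem_ofPred_eq] at *
    rw [LinearMap.comp_smul, hf, LinearMap.rTensor_smul, LinearMap.smul_comp]

/-- Objects of the category `𝓜^C` of right `C`-comodules. -/
structure RightComodCat where
  carrier : Type u
  [addCommGroup : AddCommGroup carrier]
  [module : Module R carrier]
  [comodule : RightComodule R C carrier]

attribute [instance] RightComodCat.addCommGroup RightComodCat.module RightComodCat.comodule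

/-- The category `𝓜^C` of right `C`-comodules and colinear maps. -/
instance : Category (RightComodCat R C) where
  Hom X Y := comHom R C X.carrier Y.carrier
  id X := ⟨LinearMap.id, by
    change _ = _
    rw [LinearMap.rTensor_id]; rfl⟩
  comp f g := ⟨g.1 ∘ₗ f.1, by
    have hf : _ = _ := f.2
    have hg : _ = _ := g.2
    change _ = _
    rw [LinearMap.rTensor_comp, ← LinearMap.comp_assoc, hg, LinearMap.comp_assoc, hf,
      LinearMap.comp_assoc]⟩

instance : Preadditive (RightComodCat R C) where
  homGroup X Y := inferInstanceAs (AddCommGroup (comHom R C X.carrier Y.carrier))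
  add_comp _ _ _ f f' g := Subtype.ext (LinearMap.comp_add f.1 f'.1 g.1)
  comp_add _ _ _ f g g' := Subtype.ext (LinearMap.add_comp f.1 g'.1 g.1)

instance : Linear R (RightComodCat R C) where
  homModule X Y := inferInstanceAs (Module R (comHom R C X.carrier Y.carrier))
  smul_comp _ _ _ r f g := Subtype.ext (LinearMap.comp_smul g.1 r f.1)
  comp_smul _ _ _ f r g := Subtype.ext (LinearMap.smul_comp r g.1 f.1)

/-- Two coalgebras over `R` are Morita–Takeuchi equivalent if their categories of right comodules
are equivalent. As usual for `R`-linear categories, functors are additive and `R`-linear. -/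
def MoritaTakeuchiEquivalent (D : Type u) [AddCommGroup D] [Module R D] [Coalgebra R D] : Prop :=
  ∃ e : RightComodCat R C ≌ RightComodCat R D, e.functor.Additive ∧ e.functor.Linear R

end Category

/-! ### The cotensor product -/

section Cotensor

variable (R : Type u) [CommRing R] (C : Type v) [AddCommGroup C] [Module R C] [Coalgebra R C]
  (M : Type w) [AddCommGroup M] [Module R M] [RightComodule R C M]
  (N : Type x) [AddCommGroup N] [Module R N] [LeftComodule R C N]

/-- The map `ρ_M ⊗ id - id ⊗ ρ_N : M ⊗ N → M ⊗ C ⊗ N`. -/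
def cotensorMap : M ⊗[R] N →ₗ[R] M ⊗[R] (C ⊗[R] N) :=
  (TensorProduct.assoc R M C N).toLinearMap ∘ₗ (rcoact R C M).rTensor N -
    (lcoact R C N).lTensor M

/-- The cotensor product `M □_C N`, as a submodule of `M ⊗ N`. -/
def Cotensor : Submodule R (M ⊗[R] N) := LinearMap.ker (cotensorMap R C M N)

end Cotensor

/-- A submodule `W` of an `R`-module `V` is pure if `W ⊗ X → V ⊗ X` is injective for every
`R`-module `X`. -/
def IsPure {R : Type u} [CommRing R] {V : Type u} [AddCommGroup V] [Module R V]
    (W : Submodule R V) : Prop :=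
  ∀ (X : Type u) [AddCommGroup X] [Module R X], Function.Injective (W.subtype.rTensor X)

/-! ### The comodule structures on a tensor product and on a cotensor product -/

section Flat

variable {R : Type u} [CommRing R] (D : Type v) [AddCommGroup D] [Module R D]
  [Module.Flat R D] {V : Type w} [AddCommGroup V] [Module R V]

theorem lTensor_subtype_injective (W : Submodule R V) :
    Function.Injective (W.subtype.lTensor D) :=
  Module.Flat.lTensor_preserves_injective_linearMap _ W.injective_subtype

theorem rTensor_subtype_injective (W : Submodule R V) :
    Function.Injective (W.subtype.rTensor D) :=
  Module.Flat.rTensor_preserves_injective_linearMap _ W.injective_subtype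

end Flat

section Transfer

variable {R : Type u} [CommRing R] {D : Type v} [AddCommGroup D] [Module R D] [Coalgebra R D]
  {V : Type w} [AddCommGroup V] [Module R V] {W : Type x} [AddCommGroup W] [Module R W]

theorem lcoassoc_nat (j : W →ₗ[R] V) (r : W →ₗ[R] D ⊗[R] W) (s : V →ₗ[R] D ⊗[R] V)
    (h : s ∘ₗ j = j.lTensor D ∘ₗ r) :
    ((TensorProduct.assoc R D D V).toLinearMap ∘ₗ
        (Coalgebra.comul (R := R) (A := D)).rTensor V ∘ₗ s) ∘ₗ j =
      (j.lTensor D).lTensor D ∘ₗ (TensorProduct.assoc R D D W).toLinearMap ∘ₗ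
        (Coalgebra.comul (R := R) (A := D)).rTensor W ∘ₗ r := by
  have e : (TensorProduct.assoc R D D V).toLinearMap ∘ₗ j.lTensor (D ⊗[R] D) =
      (j.lTensor D).lTensor D ∘ₗ (TensorProduct.assoc R D D W).toLinearMap := by
    ext; simp
  rw [LinearMap.comp_assoc, LinearMap.comp_assoc, h, ← LinearMap.comp_assoc r,
    LinearMap.rTensor_comp_lTensor, ← LinearMap.lTensor_comp_rTensor, LinearMap.comp_assoc,
    ← LinearMap.comp_assoc, e, LinearMap.comp_assoc]

theorem lcoassoc_nat' (j : W →ₗ[R] V) (r : W →ₗ[R] D ⊗[R] W) (s : V →ₗ[R] D ⊗[R] V)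
    (h : s ∘ₗ j = j.lTensor D ∘ₗ r) :
    (s.lTensor D ∘ₗ s) ∘ₗ j = (j.lTensor D).lTensor D ∘ₗ r.lTensor D ∘ₗ r := by
  rw [LinearMap.comp_assoc, h, ← LinearMap.comp_assoc, ← LinearMap.lTensor_comp, h,
    LinearMap.lTensor_comp, LinearMap.comp_assoc]

theorem lcounit_nat (j : W →ₗ[R] V) (r : W →ₗ[R] D ⊗[R] W) (s : V →ₗ[R] D ⊗[R] V)
    (h : s ∘ₗ j = j.lTensor D ∘ₗ r) :
    ((TensorProduct.lid R V).toLinearMap ∘ₗ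
        (Coalgebra.counit (R := R) (A := D)).rTensor V ∘ₗ s) ∘ₗ j =
      j ∘ₗ (TensorProduct.lid R W).toLinearMap ∘ₗ
        (Coalgebra.counit (R := R) (A := D)).rTensor W ∘ₗ r := by
  have e : (TensorProduct.lid R V).toLinearMap ∘ₗ j.lTensor R =
      j ∘ₗ (TensorProduct.lid R W).toLinearMap := by
    ext; simp
  rw [LinearMap.comp_assoc, LinearMap.comp_assoc, h, ← LinearMap.comp_assoc r,
    LinearMap.rTensor_comp_lTensor, ← LinearMap.lTensor_comp_rTensor, LinearMap.comp_assoc,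
    ← LinearMap.comp_assoc, e, LinearMap.comp_assoc]

theorem rcoassoc_nat (j : W →ₗ[R] V) (r : W →ₗ[R] W ⊗[R] D) (s : V →ₗ[R] V ⊗[R] D)
    (h : s ∘ₗ j = j.rTensor D ∘ₗ r) :
    ((TensorProduct.assoc R V D D).toLinearMap ∘ₗ s.rTensor D ∘ₗ s) ∘ₗ j =
      j.rTensor (D ⊗[R] D) ∘ₗ (TensorProduct.assoc R W D D).toLinearMap ∘ₗ
        r.rTensor D ∘ₗ r := by
  have e : (TensorProduct.assoc R V D D).toLinearMap ∘ₗ (j.rTensor D).rTensor D =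
      j.rTensor (D ⊗[R] D) ∘ₗ (TensorProduct.assoc R W D D).toLinearMap := by
    ext; simp
  rw [LinearMap.comp_assoc, LinearMap.comp_assoc, h, ← LinearMap.comp_assoc r,
    ← LinearMap.rTensor_comp, h, LinearMap.rTensor_comp, LinearMap.comp_assoc,
    ← LinearMap.comp_assoc, e, LinearMap.comp_assoc]

theorem rcoassoc_nat' (j : W →ₗ[R] V) (r : W →ₗ[R] W ⊗[R] D) (s : V →ₗ[R] V ⊗[R] D)
    (h : s ∘ₗ j = j.rTensor D ∘ₗ r) :
    ((Coalgebra.comul (R := R) (A := D)).lTensor V ∘ₗ s) ∘ₗ j =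
      j.rTensor (D ⊗[R] D) ∘ₗ (Coalgebra.comul (R := R) (A := D)).lTensor W ∘ₗ r := by
  rw [LinearMap.comp_assoc, h, ← LinearMap.comp_assoc, LinearMap.lTensor_comp_rTensor,
    ← LinearMap.rTensor_comp_lTensor, LinearMap.comp_assoc]

theorem rcounit_nat (j : W →ₗ[R] V) (r : W →ₗ[R] W ⊗[R] D) (s : V →ₗ[R] V ⊗[R] D)
    (h : s ∘ₗ j = j.rTensor D ∘ₗ r) :
    ((TensorProduct.rid R V).toLinearMap ∘ₗ
        (Coalgebra.counit (R := R) (A := D)).lTensor V ∘ₗ s) ∘ₗ j =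
      j ∘ₗ (TensorProduct.rid R W).toLinearMap ∘ₗ
        (Coalgebra.counit (R := R) (A := D)).lTensor W ∘ₗ r := by
  have e : (TensorProduct.rid R V).toLinearMap ∘ₗ j.rTensor R =
      j ∘ₗ (TensorProduct.rid R W).toLinearMap := by
    ext; simp
  rw [LinearMap.comp_assoc, LinearMap.comp_assoc, h, ← LinearMap.comp_assoc r,
    LinearMap.lTensor_comp_rTensor, ← LinearMap.rTensor_comp_lTensor, LinearMap.comp_assoc,
    ← LinearMap.comp_assoc, e, LinearMap.comp_assoc]

end Transfer

section Sub

variable (R : Type u) [CommRing R] (D : Type v) [AddCommGroup D] [Module R D] [Coalgebra R D]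

theorem tensorLeft_aux (M : Type w) [AddCommGroup M] [Module R M] (r : M →ₗ[R] D ⊗[R] M)
    (N : Type x) [AddCommGroup N] [Module R N] (n : N) :
    ((TensorProduct.assoc R D M N).toLinearMap ∘ₗ r.rTensor N) ∘ₗ
      (TensorProduct.mk R M N).flip n = ((TensorProduct.mk R M N).flip n).lTensor D ∘ₗ r := by
  have e : (TensorProduct.assoc R D M N).toLinearMap ∘ₗ
      (TensorProduct.mk R (D ⊗[R] M) N).flip n = ((TensorProduct.mk R M N).flip n).lTensor D := by
    ext; simp
  rw [← e]
  ext; simp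

theorem tensorRight_aux (M : Type w) [AddCommGroup M] [Module R M]
    (N : Type x) [AddCommGroup N] [Module R N] (r : N →ₗ[R] N ⊗[R] D) (m : M) :
    ((TensorProduct.assoc R M N D).symm.toLinearMap ∘ₗ r.lTensor M) ∘ₗ
      TensorProduct.mk R M N m = (TensorProduct.mk R M N m).rTensor D ∘ₗ r := by
  have e : (TensorProduct.assoc R M N D).symm.toLinearMap ∘ₗ
      TensorProduct.mk R M (N ⊗[R] D) m = (TensorProduct.mk R M N m).rTensor D := by
    ext; simp
  rw [← e]
  ext; simp

/-- `M ⊗ N` as a left comodule, through a left coaction on `M`. -/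
instance tensorLeft (M : Type w) [AddCommGroup M] [Module R M] [LeftComodule R D M]
    (N : Type x) [AddCommGroup N] [Module R N] : LeftComodule R D (M ⊗[R] N) where
  coact := (TensorProduct.assoc R D M N).toLinearMap ∘ₗ (lcoact R D M).rTensor N
  coassoc := by
    refine TensorProduct.ext' fun m n => ?_
    have a := lcoassoc_nat _ _ _ (tensorLeft_aux R D M (lcoact R D M) N n)
    have b := lcoassoc_nat' _ _ _ (tensorLeft_aux R D M (lcoact R D M) N n)
    rw [LeftComodule.coassoc, ← b] at a
    exact LinearMap.congr_fun a m
  counit_coact := by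
    refine TensorProduct.ext' fun m n => ?_
    have a := lcounit_nat _ _ _ (tensorLeft_aux R D M (lcoact R D M) N n)
    rw [LeftComodule.counit_coact] at a
    exact LinearMap.congr_fun a m

/-- `M ⊗ N` as a right comodule, through a right coaction on `N`. -/
instance tensorRight (M : Type w) [AddCommGroup M] [Module R M]
    (N : Type x) [AddCommGroup N] [Module R N] [RightComodule R D N] :
    RightComodule R D (M ⊗[R] N) where
  coact := (TensorProduct.assoc R M N D).symm.toLinearMap ∘ₗ (rcoact R D N).lTensor M
  coassoc := by
    refine TensorProduct.ext' fun m n => ?_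
    have a := rcoassoc_nat _ _ _ (tensorRight_aux R D M N (rcoact R D N) m)
    have b := rcoassoc_nat' _ _ _ (tensorRight_aux R D M N (rcoact R D N) m)
    rw [RightComodule.coassoc, ← b] at a
    exact LinearMap.congr_fun a n
  counit_coact := by
    refine TensorProduct.ext' fun m n => ?_
    have a := rcounit_nat _ _ _ (tensorRight_aux R D M N (rcoact R D N) m)
    rw [RightComodule.counit_coact] at a
    exact LinearMap.congr_fun a n

variable {R} [Module.Flat R D] {V : Type w} [AddCommGroup V] [Module R V]

/-- If `D` is flat and the coaction of `V` maps `W` into `D ⊗ W ⊆ D ⊗ V`, this is the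
restricted coaction `W → D ⊗ W`. -/
noncomputable def subLeftCoact [LeftComodule R D V] (W : Submodule R V)
    (h : ∀ m : W, lcoact R D V m ∈ LinearMap.range (W.subtype.lTensor D)) : W →ₗ[R] D ⊗[R] W :=
  (LinearEquiv.ofInjective _ (lTensor_subtype_injective D W)).symm.toLinearMap ∘ₗ
    (lcoact R D V ∘ₗ W.subtype).codRestrict _ h

theorem subLeftCoact_spec [LeftComodule R D V] (W : Submodule R V)
    (h : ∀ m : W, lcoact R D V m ∈ LinearMap.range (W.subtype.lTensor D)) :
    lcoact R D V ∘ₗ W.subtype = W.subtype.lTensor D ∘ₗ subLeftCoact D W h := by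
  ext m
  exact (congrArg Subtype.val ((LinearEquiv.ofInjective _
    (lTensor_subtype_injective D W)).apply_symm_apply
      ((lcoact R D V ∘ₗ W.subtype).codRestrict _ h m))).symm

/-- If `D` is flat and the coaction of `V` maps `W` into `W ⊗ D ⊆ V ⊗ D`, this is the
restricted coaction `W → W ⊗ D`. -/
noncomputable def subRightCoact [RightComodule R D V] (W : Submodule R V)
    (h : ∀ m : W, rcoact R D V m ∈ LinearMap.range (W.subtype.rTensor D)) : W →ₗ[R] W ⊗[R] D :=
  (LinearEquiv.ofInjective _ (rTensor_subtype_injective D W)).symm.toLinearMap ∘ₗ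
    (rcoact R D V ∘ₗ W.subtype).codRestrict _ h

theorem subRightCoact_spec [RightComodule R D V] (W : Submodule R V)
    (h : ∀ m : W, rcoact R D V m ∈ LinearMap.range (W.subtype.rTensor D)) :
    rcoact R D V ∘ₗ W.subtype = W.subtype.rTensor D ∘ₗ subRightCoact D W h := by
  ext m
  exact (congrArg Subtype.val ((LinearEquiv.ofInjective _
    (rTensor_subtype_injective D W)).apply_symm_apply
      ((rcoact R D V ∘ₗ W.subtype).codRestrict _ h m))).symm

/-- Subcomodules of a left comodule. -/
noncomputable abbrev subLeft [LeftComodule R D V] (W : Submodule R V)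
    (h : ∀ m : W, lcoact R D V m ∈ LinearMap.range (W.subtype.lTensor D)) :
    LeftComodule R D W where
  coact := subLeftCoact D W h
  coassoc := by
    have a := lcoassoc_nat _ _ _ (subLeftCoact_spec D W h)
    have b := lcoassoc_nat' _ _ _ (subLeftCoact_spec D W h)
    rw [LeftComodule.coassoc, b] at a
    refine LinearMap.ext fun m => ?_
    exact (Module.Flat.lTensor_preserves_injective_linearMap (M := D) _
      (lTensor_subtype_injective D W) (LinearMap.congr_fun a m)).symm
  counit_coact := by
    have a := lcounit_nat _ _ _ (subLeftCoact_spec D W h)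
    rw [LeftComodule.counit_coact] at a
    exact LinearMap.ext fun m => (W.injective_subtype (LinearMap.congr_fun a m)).symm

/-- Subcomodules of a right comodule. -/
noncomputable abbrev subRight [RightComodule R D V] (W : Submodule R V)
    (h : ∀ m : W, rcoact R D V m ∈ LinearMap.range (W.subtype.rTensor D)) :
    RightComodule R D W where
  coact := subRightCoact D W h
  coassoc := by
    have a := rcoassoc_nat _ _ _ (subRightCoact_spec D W h)
    have b := rcoassoc_nat' _ _ _ (subRightCoact_spec D W h)
    rw [RightComodule.coassoc, b] at a
    refine LinearMap.ext fun m => ?_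
    exact (rTensor_subtype_injective (D ⊗[R] D) W (LinearMap.congr_fun a m)).symm
  counit_coact := by
    have a := rcounit_nat _ _ _ (subRightCoact_spec D W h)
    rw [RightComodule.counit_coact] at a
    exact LinearMap.ext fun m => (W.injective_subtype (LinearMap.congr_fun a m)).symm

end Sub

section CotensorComodule

variable {R : Type u} [CommRing R] {C : Type v} [AddCommGroup C] [Module R C] [Coalgebra R C]
  {D : Type y} [AddCommGroup D] [Module R D] [Coalgebra R D]
  {M : Type w} [AddCommGroup M] [Module R M] [RightComodule R C M]
  {N : Type x} [AddCommGroup N] [Module R N] [LeftComodule R C N]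

theorem cotensorMap_leftColinear [LeftComodule R D M] [IsBicomodule R D C M] :
    IsLeftColinear R D (cotensorMap R C M N) := by
  refine TensorProduct.ext' fun m n => ?_
  have A : ∀ z : D ⊗[R] M, ((TensorProduct.assoc R M C N).toLinearMap ∘ₗ
        (rcoact R C M).rTensor N).lTensor D (TensorProduct.assoc R D M N (z ⊗ₜ n)) =
      ((TensorProduct.assoc R M C N).toLinearMap ∘ₗ
        (TensorProduct.mk R (M ⊗[R] C) N).flip n).lTensor D ((rcoact R C M).lTensor D z) := by
    intro z
    induction z with
    | zero => simp
    | add a b ha hb => simp only [TensorProduct.add_tmul, map_add, ha, hb]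
    | tmul d m => simp
  have B : ∀ y : M ⊗[R] C, lcoact R D (M ⊗[R] (C ⊗[R] N))
        (TensorProduct.assoc R M C N (y ⊗ₜ n)) =
      ((TensorProduct.assoc R M C N).toLinearMap ∘ₗ
        (TensorProduct.mk R (M ⊗[R] C) N).flip n).lTensor D
        (TensorProduct.assoc R D M C ((lcoact R D M).rTensor C y)) := by
    intro y
    induction y with
    | zero => simp
    | add a b ha hb => simp only [TensorProduct.add_tmul, map_add, ha, hb]
    | tmul m c =>
      change TensorProduct.assoc R D M (C ⊗[R] N) (lcoact R D M m ⊗ₜ (c ⊗ₜ n)) =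
        LinearMap.lTensor D _ (TensorProduct.assoc R D M C (lcoact R D M m ⊗ₜ c))
      generalize lcoact R D M m = q
      induction q with
      | zero => simp
      | add a b ha hb => simp only [TensorProduct.add_tmul, map_add, ha, hb]
      | tmul d m => simp
  have E : ∀ z : D ⊗[R] M, ((lcoact R C N).lTensor M).lTensor D
      (TensorProduct.assoc R D M N (z ⊗ₜ n)) =
      TensorProduct.assoc R D M (C ⊗[R] N) (z ⊗ₜ lcoact R C N n) := by
    intro z
    induction z with
    | zero => simp
    | add a b ha hb => simp only [TensorProduct.add_tmul, map_add, ha, hb]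
    | tmul d m => simp
  have comm := LinearMap.congr_fun (IsBicomodule.comm (R := R) (C := D) (D := C) (M := M)) m
  simp only [LinearMap.comp_apply, LinearEquiv.coe_coe] at comm
  change lcoact R D (M ⊗[R] (C ⊗[R] N)) (TensorProduct.assoc R M C N (rcoact R C M m ⊗ₜ n) -
      m ⊗ₜ lcoact R C N n) = (cotensorMap R C M N).lTensor D
        (TensorProduct.assoc R D M N (lcoact R D M m ⊗ₜ n))
  rw [map_sub, B, cotensorMap, LinearMap.lTensor_sub, LinearMap.sub_apply, A, E, comm]
  rfl

theorem cotensorMap_rightColinear [RightComodule R D N] [IsBicomodule R C D N] :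
    IsRightColinear R D (cotensorMap R C M N) := by
  refine TensorProduct.ext' fun m n => ?_
  have A : ∀ z : N ⊗[R] D, ((lcoact R C N).lTensor M).rTensor D
        ((TensorProduct.assoc R M N D).symm (m ⊗ₜ z)) =
      (TensorProduct.mk R M (C ⊗[R] N) m).rTensor D ((lcoact R C N).rTensor D z) := by
    intro z
    induction z with
    | zero => simp
    | add a b ha hb => simp only [TensorProduct.tmul_add, map_add, ha, hb]
    | tmul n d => simp
  have B : ∀ y : C ⊗[R] N, rcoact R D (M ⊗[R] (C ⊗[R] N)) (m ⊗ₜ y) =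
      (TensorProduct.mk R M (C ⊗[R] N) m).rTensor D
        ((TensorProduct.assoc R C N D).symm ((rcoact R D N).lTensor C y)) := by
    intro y
    exact LinearMap.congr_fun (tensorRight_aux R D M (C ⊗[R] N) (rcoact R D (C ⊗[R] N)) m) y
  have E : ∀ q : M ⊗[R] C, rcoact R D (M ⊗[R] (C ⊗[R] N)) (TensorProduct.assoc R M C N (q ⊗ₜ n)) =
      ((TensorProduct.assoc R M C N).toLinearMap ∘ₗ
        TensorProduct.mk R (M ⊗[R] C) N q).rTensor D (rcoact R D N n) := by
    intro q
    induction q with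
    | zero => simp
    | add a b ha hb =>
      simp only [TensorProduct.add_tmul, map_add, ha, hb, LinearMap.comp_add,
        LinearMap.rTensor_add, LinearMap.add_apply]
    | tmul m c =>
      rw [TensorProduct.assoc_tmul]
      change (TensorProduct.assoc R M (C ⊗[R] N) D).symm (m ⊗ₜ
        ((TensorProduct.assoc R C N D).symm (c ⊗ₜ rcoact R D N n))) = _
      generalize rcoact R D N n = z
      induction z with
      | zero => simp
      | add a b ha hb => simp only [TensorProduct.tmul_add, map_add, ha, hb]
      | tmul n d => simp
  have F : ∀ z : N ⊗[R] D, ((TensorProduct.assoc R M C N).toLinearMap ∘ₗ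
        (rcoact R C M).rTensor N).rTensor D ((TensorProduct.assoc R M N D).symm (m ⊗ₜ z)) =
      ((TensorProduct.assoc R M C N).toLinearMap ∘ₗ
        TensorProduct.mk R (M ⊗[R] C) N (rcoact R C M m)).rTensor D z := by
    intro z
    induction z with
    | zero => simp
    | add a b ha hb => simp only [TensorProduct.tmul_add, map_add, ha, hb]
    | tmul n d => simp
  have comm := LinearMap.congr_fun (IsBicomodule.comm (R := R) (C := C) (D := D) (M := N)) n
  simp only [LinearMap.comp_apply, LinearEquiv.coe_coe] at comm
  change rcoact R D (M ⊗[R] (C ⊗[R] N)) (TensorProduct.assoc R M C N (rcoact R C M m ⊗ₜ n) -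
      m ⊗ₜ lcoact R C N n) = (cotensorMap R C M N).rTensor D
        ((TensorProduct.assoc R M N D).symm (m ⊗ₜ rcoact R D N n))
  rw [map_sub, B, cotensorMap, LinearMap.rTensor_sub, LinearMap.sub_apply, F, E, A, ← comm,
    LinearEquiv.symm_apply_apply]

theorem exact_cotensor :
    Function.Exact (Cotensor R C M N).subtype (cotensorMap R C M N) :=
  LinearMap.exact_subtype_ker_map _

theorem cotensor_lcoact_mem [Module.Flat R D] [LeftComodule R D M] [IsBicomodule R D C M]
    (t : Cotensor R C M N) : lcoact R D (M ⊗[R] N) t ∈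
      LinearMap.range ((Cotensor R C M N).subtype.lTensor D) := by
  refine (Module.Flat.lTensor_exact D exact_cotensor _).1 ?_
  have h := LinearMap.congr_fun (cotensorMap_leftColinear (R := R) (C := C) (D := D) (M := M)
    (N := N)) t
  have h0 : cotensorMap R C M N t = 0 := t.2
  rw [LinearMap.comp_apply, h0, map_zero] at h
  exact h.symm

theorem cotensor_rcoact_mem [Module.Flat R D] [RightComodule R D N] [IsBicomodule R C D N]
    (t : Cotensor R C M N) : rcoact R D (M ⊗[R] N) t ∈
      LinearMap.range ((Cotensor R C M N).subtype.rTensor D) := by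
  refine (Module.Flat.rTensor_exact D exact_cotensor _).1 ?_
  have h := LinearMap.congr_fun (cotensorMap_rightColinear (R := R) (C := C) (D := D) (M := M)
    (N := N)) t
  have h0 : cotensorMap R C M N t = 0 := t.2
  rw [LinearMap.comp_apply, h0, map_zero] at h
  exact h.symm

/-- For a `D`-`C`-bicomodule `M`, the cotensor product `M □_C N` is a left `D`-subcomodule of
`M ⊗ N`. -/
noncomputable instance cotensorLeft [Module.Flat R D] [LeftComodule R D M]
    [IsBicomodule R D C M] : LeftComodule R D (Cotensor R C M N) :=
  subLeft D (Cotensor R C M N) cotensor_lcoact_mem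

/-- For a `C`-`D`-bicomodule `N`, the cotensor product `M □_C N` is a right `D`-subcomodule of
`M ⊗ N`. -/
noncomputable instance cotensorRight [Module.Flat R D] [RightComodule R D N]
    [IsBicomodule R C D N] : RightComodule R D (Cotensor R C M N) :=
  subRight D (Cotensor R C M N) cotensor_rcoact_mem

theorem cotensor_subtype_leftColinear [Module.Flat R D] [LeftComodule R D M]
    [IsBicomodule R D C M] : IsLeftColinear R D (Cotensor R C M N).subtype :=
  subLeftCoact_spec D (Cotensor R C M N) cotensor_lcoact_mem

theorem cotensor_subtype_rightColinear [Module.Flat R D] [RightComodule R D N]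
    [IsBicomodule R C D N] : IsRightColinear R D (Cotensor R C M N).subtype :=
  subRightCoact_spec D (Cotensor R C M N) cotensor_rcoact_mem

/-- The cotensor product of two bicomodules is a bicomodule. -/
instance cotensorBicomodule {E : Type z} [AddCommGroup E] [Module R E] [Coalgebra R E]
    [Module.Flat R D] [Module.Flat R E] [LeftComodule R D M] [IsBicomodule R D C M]
    [RightComodule R E N] [IsBicomodule R C E N] :
    IsBicomodule R D E (Cotensor R C M N) where
  comm := by
    have hV : (TensorProduct.assoc R D (M ⊗[R] N) E).toLinearMap ∘ₗ
        (lcoact R D (M ⊗[R] N)).rTensor E ∘ₗ rcoact R E (M ⊗[R] N) =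
        (rcoact R E (M ⊗[R] N)).lTensor D ∘ₗ lcoact R D (M ⊗[R] N) := by
      refine TensorProduct.ext' fun m n => ?_
      change TensorProduct.assoc R D (M ⊗[R] N) E ((lcoact R D (M ⊗[R] N)).rTensor E
          ((TensorProduct.assoc R M N E).symm (m ⊗ₜ rcoact R E N n))) =
        (rcoact R E (M ⊗[R] N)).lTensor D (TensorProduct.assoc R D M N (lcoact R D M m ⊗ₜ n))
      have P : ∀ q : N ⊗[R] E, TensorProduct.assoc R D (M ⊗[R] N) E
          ((lcoact R D (M ⊗[R] N)).rTensor E ((TensorProduct.assoc R M N E).symm (m ⊗ₜ q))) =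
          (TensorProduct.assoc R M N E).symm.toLinearMap.lTensor D
            (TensorProduct.assoc R D M (N ⊗[R] E) (lcoact R D M m ⊗ₜ q)) := by
        intro q
        induction q with
        | zero => simp
        | add a b ha hb => simp only [TensorProduct.tmul_add, map_add, ha, hb]
        | tmul n e =>
          change TensorProduct.assoc R D (M ⊗[R] N) E
            (TensorProduct.assoc R D M N (lcoact R D M m ⊗ₜ n) ⊗ₜ e) = _
          generalize lcoact R D M m = p
          induction p with
          | zero => simp
          | add a b ha hb => simp only [TensorProduct.add_tmul, map_add, ha, hb]
          | tmul d m => simp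
      have Q : ∀ p : D ⊗[R] M, (rcoact R E (M ⊗[R] N)).lTensor D
          (TensorProduct.assoc R D M N (p ⊗ₜ n)) =
          (TensorProduct.assoc R M N E).symm.toLinearMap.lTensor D
            (TensorProduct.assoc R D M (N ⊗[R] E) (p ⊗ₜ rcoact R E N n)) := by
        intro p
        induction p with
        | zero => simp
        | add a b ha hb => simp only [TensorProduct.add_tmul, map_add, ha, hb]
        | tmul d m => rfl
      rw [P, Q]
    have hl : _ = _ := cotensor_subtype_leftColinear (R := R) (C := C) (D := D) (M := M) (N := N)
    have hr : _ = _ := cotensor_subtype_rightColinear (R := R) (C := C) (D := E) (M := M) (N := N)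
    have e : (TensorProduct.assoc R D (M ⊗[R] N) E).toLinearMap ∘ₗ
        ((Cotensor R C M N).subtype.lTensor D).rTensor E =
        ((Cotensor R C M N).subtype.rTensor E).lTensor D ∘ₗ
          (TensorProduct.assoc R D (Cotensor R C M N) E).toLinearMap := by
      ext; simp
    refine LinearMap.ext fun t => Module.Flat.lTensor_preserves_injective_linearMap (M := D) _
      (rTensor_subtype_injective E (Cotensor R C M N)) ?_
    refine LinearMap.congr_fun (f := LinearMap.lTensor D _ ∘ₗ _) (g := LinearMap.lTensor D _ ∘ₗ _)
      ?_ t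
    rw [← LinearMap.comp_assoc, ← e, LinearMap.comp_assoc, ← LinearMap.comp_assoc (rcoact R E _),
      ← LinearMap.rTensor_comp, ← hl, LinearMap.rTensor_comp, LinearMap.comp_assoc, ← hr,
      ← LinearMap.comp_assoc (lcoact R D _), ← LinearMap.lTensor_comp, ← hr,
      LinearMap.lTensor_comp, LinearMap.comp_assoc, ← hl, ← LinearMap.comp_assoc,
      ← LinearMap.comp_assoc, LinearMap.comp_assoc _ _ (TensorProduct.assoc R D _ E).toLinearMap,
      hV, LinearMap.comp_assoc]

end CotensorComodule

section CotensorFunctor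

variable {R : Type u} [CommRing R] {C : Type v} [AddCommGroup C] [Module R C] [Coalgebra R C]
  (M : Type w) [AddCommGroup M] [Module R M]
  (N : Type x) [AddCommGroup N] [Module R N]

theorem cotensorMap_lTensor [RightComodule R C M] [LeftComodule R C N] {N' : Type y}
    [AddCommGroup N'] [Module R N'] [LeftComodule R C N']
    (g : N →ₗ[R] N') (hg : IsLeftColinear R C g) :
    cotensorMap R C M N' ∘ₗ g.lTensor M = (g.lTensor C).lTensor M ∘ₗ cotensorMap R C M N := by
  have e : (TensorProduct.assoc R M C N').toLinearMap ∘ₗ g.lTensor (M ⊗[R] C) =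
      (g.lTensor C).lTensor M ∘ₗ (TensorProduct.assoc R M C N).toLinearMap := by
    ext; simp
  rw [cotensorMap, cotensorMap, LinearMap.sub_comp, LinearMap.comp_sub, LinearMap.comp_assoc,
    LinearMap.rTensor_comp_lTensor, ← LinearMap.lTensor_comp_rTensor, ← LinearMap.comp_assoc, e,
    LinearMap.comp_assoc, ← LinearMap.lTensor_comp, hg, LinearMap.lTensor_comp]

theorem cotensorMap_rTensor [LeftComodule R C N] [RightComodule R C M] {M' : Type y}
    [AddCommGroup M'] [Module R M'] [RightComodule R C M']
    (f : M →ₗ[R] M') (hf : IsRightColinear R C f) :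
    cotensorMap R C M' N ∘ₗ f.rTensor N = f.rTensor (C ⊗[R] N) ∘ₗ cotensorMap R C M N := by
  have e : (TensorProduct.assoc R M' C N).toLinearMap ∘ₗ (f.rTensor C).rTensor N =
      f.rTensor (C ⊗[R] N) ∘ₗ (TensorProduct.assoc R M C N).toLinearMap := by
    ext; simp
  rw [cotensorMap, cotensorMap, LinearMap.sub_comp, LinearMap.comp_sub, LinearMap.comp_assoc,
    ← LinearMap.rTensor_comp, hf, LinearMap.rTensor_comp, ← LinearMap.comp_assoc, e,
    LinearMap.comp_assoc, LinearMap.lTensor_comp_rTensor, LinearMap.rTensor_comp_lTensor]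

variable {N} in
/-- The map `id □ g : M □_C N → M □_C N'` induced by a left colinear map `g : N → N'`. -/
def Cotensor.mapRight [RightComodule R C M] [LeftComodule R C N] {N' : Type y}
    [AddCommGroup N'] [Module R N'] [LeftComodule R C N']
    (g : N →ₗ[R] N') (hg : IsLeftColinear R C g) :
    Cotensor R C M N →ₗ[R] Cotensor R C M N' :=
  (g.lTensor M).restrict fun t ht => by
    have h := LinearMap.congr_fun (cotensorMap_lTensor M N g hg) t
    have h0 : cotensorMap R C M N t = 0 := ht
    rwa [LinearMap.comp_apply, LinearMap.comp_apply, h0, map_zero] at h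

variable {M} in
/-- The map `f □ id : M □_C N → M' □_C N` induced by a right colinear map `f : M → M'`. -/
def Cotensor.mapLeft [RightComodule R C M] [LeftComodule R C N] {M' : Type y}
    [AddCommGroup M'] [Module R M'] [RightComodule R C M']
    (f : M →ₗ[R] M') (hf : IsRightColinear R C f) :
    Cotensor R C M N →ₗ[R] Cotensor R C M' N :=
  (f.rTensor N).restrict fun t ht => by
    have h := LinearMap.congr_fun (cotensorMap_rTensor M N f hf) t
    have h0 : cotensorMap R C M N t = 0 := ht
    rwa [LinearMap.comp_apply, LinearMap.comp_apply, h0, map_zero] at h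

variable (R C) in
/-- The canonical isomorphism `M ≅ M □_C C`, given by the coaction of `M`. -/
noncomputable def Cotensor.rightUnit [RightComodule R C M] : M ≃ₗ[R] Cotensor R C M C :=
  LinearEquiv.ofLinearMap
    ((rcoact R C M).codRestrict _ fun m => by
      have h := LinearMap.congr_fun (RightComodule.coassoc (R := R) (C := C) (M := M)) m
      exact sub_eq_zero.2 h)
    ((TensorProduct.rid R M).toLinearMap ∘ₗ
      (Coalgebra.counit (R := R) (A := C)).lTensor M ∘ₗ (Cotensor R C M C).subtype)
    (LinearMap.ext fun t => Subtype.ext (by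
      have h1 : (TensorProduct.assoc R M C C).toLinearMap ((rcoact R C M).rTensor C t) =
        (Coalgebra.comul (R := R) (A := C)).lTensor M t := sub_eq_zero.1 t.2
      have h2 : ((TensorProduct.rid R C).toLinearMap ∘ₗ (Coalgebra.counit (R := R) (A := C)).lTensor
          C).lTensor M ∘ₗ (Coalgebra.comul (R := R) (A := C)).lTensor M = LinearMap.id := by
        rw [← LinearMap.lTensor_comp, LinearMap.comp_assoc]
        exact (congrArg (LinearMap.lTensor M) (RightComodule.counit_coact (C := C) (M := C))).trans
          (LinearMap.lTensor_id _ _)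
      have h3 : ((TensorProduct.rid R C).toLinearMap ∘ₗ (Coalgebra.counit (R := R) (A := C)).lTensor
          C).lTensor M ∘ₗ (TensorProduct.assoc R M C C).toLinearMap ∘ₗ (rcoact R C M).rTensor C =
          rcoact R C M ∘ₗ (TensorProduct.rid R M).toLinearMap ∘ₗ
            (Coalgebra.counit (R := R) (A := C)).lTensor M := by
        refine TensorProduct.ext' fun m c => ?_
        simp only [LinearMap.comp_apply, LinearMap.rTensor_tmul, LinearMap.lTensor_tmul,
          LinearEquiv.coe_coe, TensorProduct.rid_tmul, map_smul]
        generalize rcoact R C M m = q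
        induction q with
        | zero => simp
        | add a b ha hb => simp only [TensorProduct.add_tmul, map_add, ha, hb, smul_add]
        | tmul m d => simp
      exact (LinearMap.congr_fun h3 t).symm.trans ((congrArg _ h1).trans
        (LinearMap.congr_fun h2 t))))
    (RightComodule.counit_coact)

variable (R C) in
/-- The canonical isomorphism `N ≅ C □_C N`, given by the coaction of `N`. -/
noncomputable def Cotensor.leftUnit [LeftComodule R C N] : N ≃ₗ[R] Cotensor R C C N :=
  LinearEquiv.ofLinearMap
    ((lcoact R C N).codRestrict _ fun n => by
      have h := LinearMap.congr_fun (LeftComodule.coassoc (R := R) (C := C) (M := N)) n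
      exact sub_eq_zero.2 h)
    ((TensorProduct.lid R N).toLinearMap ∘ₗ
      (Coalgebra.counit (R := R) (A := C)).rTensor N ∘ₗ (Cotensor R C C N).subtype)
    (LinearMap.ext fun t => Subtype.ext (by
      have h1 : (TensorProduct.assoc R C C N).toLinearMap
          ((Coalgebra.comul (R := R) (A := C)).rTensor N t) =
        (lcoact R C N).lTensor C t := sub_eq_zero.1 t.2
      have h2 : (TensorProduct.lid R (C ⊗[R] N)).toLinearMap ∘ₗ
          (Coalgebra.counit (R := R) (A := C)).rTensor (C ⊗[R] N) ∘ₗ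
          (TensorProduct.assoc R C C N).toLinearMap ∘ₗ
          (Coalgebra.comul (R := R) (A := C)).rTensor N = LinearMap.id :=
        LeftComodule.counit_coact (R := R) (C := C) (M := C ⊗[R] N)
      have h3 : (TensorProduct.lid R (C ⊗[R] N)).toLinearMap ∘ₗ
          (Coalgebra.counit (R := R) (A := C)).rTensor (C ⊗[R] N) ∘ₗ (lcoact R C N).lTensor C =
          lcoact R C N ∘ₗ (TensorProduct.lid R N).toLinearMap ∘ₗ
            (Coalgebra.counit (R := R) (A := C)).rTensor N := by
        refine TensorProduct.ext' fun c n => ?_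
        simp
      exact (LinearMap.congr_fun h3 t).symm.trans
        ((congrArg ((TensorProduct.lid R (C ⊗[R] N)).toLinearMap ∘ₗ
          (Coalgebra.counit (R := R) (A := C)).rTensor (C ⊗[R] N)) h1.symm).trans
          (LinearMap.congr_fun h2 t))))
    (LeftComodule.counit_coact)

end CotensorFunctor

/-! ### Associativity of the cotensor product -/

section Assoc

variable (R : Type u) [CommRing R] (C : Type v) [AddCommGroup C] [Module R C] [Coalgebra R C]
  (D : Type z) [AddCommGroup D] [Module R D] [Coalgebra R D]
  [Module.Flat R C] [Module.Flat R D]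
  (M : Type w) [AddCommGroup M] [Module R M] [RightComodule R C M]
  (N : Type x) [AddCommGroup N] [Module R N] [LeftComodule R C N] [RightComodule R D N]
  [IsBicomodule R C D N]
  (P : Type y) [AddCommGroup P] [Module R P] [LeftComodule R D P]

/-- The canonical map `(M □_C N) □_D P → M ⊗ N ⊗ P`. -/
noncomputable def Cotensor.inclLeft :
    Cotensor R D (Cotensor R C M N) P →ₗ[R] M ⊗[R] (N ⊗[R] P) :=
  (TensorProduct.assoc R M N P).toLinearMap ∘ₗ (Cotensor R C M N).subtype.rTensor P ∘ₗ
    (Cotensor R D (Cotensor R C M N) P).subtype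

/-- The canonical map `M □_C (N □_D P) → M ⊗ N ⊗ P`. -/
noncomputable def Cotensor.inclRight :
    Cotensor R C M (Cotensor R D N P) →ₗ[R] M ⊗[R] (N ⊗[R] P) :=
  (Cotensor R D N P).subtype.lTensor M ∘ₗ (Cotensor R C M (Cotensor R D N P)).subtype

theorem Cotensor.inclLeft_injective [Module.Flat R P] :
    Function.Injective (Cotensor.inclLeft R C D M N P) :=
  (TensorProduct.assoc R M N P).injective.comp
    ((rTensor_subtype_injective P _).comp (Submodule.injective_subtype _))

theorem Cotensor.inclRight_injective [Module.Flat R M] :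
    Function.Injective (Cotensor.inclRight R C D M N P) :=
  (lTensor_subtype_injective M _).comp (Submodule.injective_subtype _)

theorem Cotensor.range_inclRight [Module.Flat R M] :
    LinearMap.range (Cotensor.inclRight R C D M N P) =
      LinearMap.ker (cotensorMap R C M (N ⊗[R] P)) ⊓
        LinearMap.ker ((cotensorMap R D N P).lTensor M) := by
  have hnat := cotensorMap_lTensor (R := R) (C := C) M (Cotensor R D N P)
    (Cotensor R D N P).subtype cotensor_subtype_leftColinear
  ext t
  simp only [Submodule.mem_inf, LinearMap.mem_ker, LinearMap.mem_range]
  constructor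
  · rintro ⟨s, rfl⟩
    constructor
    · have h := LinearMap.congr_fun hnat s
      have h0 : cotensorMap R C M (Cotensor R D N P) s = 0 := s.2
      rw [LinearMap.comp_apply, LinearMap.comp_apply, h0, map_zero] at h
      exact h
    · exact (Module.Flat.lTensor_exact M exact_cotensor _).2 ⟨s, rfl⟩
  · rintro ⟨h1, h2⟩
    obtain ⟨s, rfl⟩ := (Module.Flat.lTensor_exact M exact_cotensor _).1 h2
    refine ⟨⟨s, ?_⟩, rfl⟩
    have h := LinearMap.congr_fun hnat s
    rw [LinearMap.comp_apply, h1] at h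
    exact Module.Flat.lTensor_preserves_injective_linearMap (M := M) _
      (lTensor_subtype_injective C (Cotensor R D N P)) (h.symm.trans (map_zero _).symm)

theorem Cotensor.range_inclLeft [Module.Flat R P] :
    LinearMap.range (Cotensor.inclLeft R C D M N P) =
      LinearMap.ker (cotensorMap R C M (N ⊗[R] P)) ⊓
        LinearMap.ker ((cotensorMap R D N P).lTensor M) := by
  have hnat := cotensorMap_rTensor (R := R) (C := D) (Cotensor R C M N) P
    (Cotensor R C M N).subtype cotensor_subtype_rightColinear
  have hA : cotensorMap R C M (N ⊗[R] P) ∘ₗ (TensorProduct.assoc R M N P).toLinearMap =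
      ((TensorProduct.assoc R C N P).toLinearMap.lTensor M ∘ₗ
        (TensorProduct.assoc R M (C ⊗[R] N) P).toLinearMap) ∘ₗ
        (cotensorMap R C M N).rTensor P := by
    refine TensorProduct.ext_threefold fun m n p => ?_
    change TensorProduct.assoc R M C (N ⊗[R] P) (rcoact R C M m ⊗ₜ (n ⊗ₜ p)) -
        m ⊗ₜ (TensorProduct.assoc R C N P (lcoact R C N n ⊗ₜ p)) =
      (TensorProduct.assoc R C N P).toLinearMap.lTensor M
        (TensorProduct.assoc R M (C ⊗[R] N) P
          ((TensorProduct.assoc R M C N (rcoact R C M m ⊗ₜ n) - m ⊗ₜ lcoact R C N n) ⊗ₜ p))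
    rw [TensorProduct.sub_tmul, map_sub, map_sub, TensorProduct.assoc_tmul, LinearMap.lTensor_tmul]
    congr 1
    generalize rcoact R C M m = q
    induction q with
    | zero => simp
    | add a b ha hb => simp only [TensorProduct.add_tmul, map_add, ha, hb]
    | tmul m c => simp
  have hB : (cotensorMap R D N P).lTensor M ∘ₗ (TensorProduct.assoc R M N P).toLinearMap =
      (TensorProduct.assoc R M N (D ⊗[R] P)).toLinearMap ∘ₗ cotensorMap R D (M ⊗[R] N) P := by
    refine TensorProduct.ext_threefold fun m n p => ?_
    change m ⊗ₜ (TensorProduct.assoc R N D P (rcoact R D N n ⊗ₜ p) - n ⊗ₜ lcoact R D P p) =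
      TensorProduct.assoc R M N (D ⊗[R] P)
        (TensorProduct.assoc R (M ⊗[R] N) D P
          ((TensorProduct.assoc R M N D).symm (m ⊗ₜ rcoact R D N n) ⊗ₜ p) -
          (m ⊗ₜ n) ⊗ₜ lcoact R D P p)
    rw [TensorProduct.tmul_sub, map_sub, TensorProduct.assoc_tmul]
    congr 1
    generalize rcoact R D N n = q
    induction q with
    | zero => simp
    | add a b ha hb => simp only [TensorProduct.tmul_add, TensorProduct.add_tmul, map_add, ha, hb]
    | tmul n d => simp
  ext t
  obtain ⟨t, rfl⟩ := (TensorProduct.assoc R M N P).surjective t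
  have hA := LinearMap.congr_fun hA t
  have hB := LinearMap.congr_fun hB t
  simp only [LinearMap.comp_apply, LinearEquiv.coe_coe] at hA hB
  have iA : Function.Injective ((TensorProduct.assoc R C N P).toLinearMap.lTensor M) :=
    ((TensorProduct.assoc R C N P).lTensor M).injective
  rw [Submodule.mem_inf, LinearMap.mem_ker, LinearMap.mem_ker, hA, hB,
    LinearEquiv.map_eq_zero_iff, map_eq_zero_iff _ iA, LinearEquiv.map_eq_zero_iff,
    LinearMap.mem_range]
  constructor
  · rintro ⟨s, hs⟩
    have hs := (TensorProduct.assoc R M N P).injective hs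
    subst hs
    constructor
    · exact (Module.Flat.rTensor_exact P exact_cotensor _).2 ⟨s, rfl⟩
    · have h := LinearMap.congr_fun hnat s
      have h0 : cotensorMap R D (Cotensor R C M N) P s = 0 := s.2
      rw [LinearMap.comp_apply, LinearMap.comp_apply, h0, map_zero] at h
      exact h
  · rintro ⟨h1, h2⟩
    obtain ⟨s, rfl⟩ := (Module.Flat.rTensor_exact P exact_cotensor _).1 h1
    refine ⟨⟨s, ?_⟩, rfl⟩
    have h := LinearMap.congr_fun hnat s
    rw [LinearMap.comp_apply, h2] at h
    exact rTensor_subtype_injective (D ⊗[R] P) (Cotensor R C M N)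
      (h.symm.trans (map_zero _).symm)

/-- The canonical isomorphism `(M □_C N) □_D P ≅ M □_C (N □_D P)` for flat `M` and `P`: the one
compatible with the canonical maps of both sides into `M ⊗ N ⊗ P`. -/
noncomputable def Cotensor.assoc [Module.Flat R M] [Module.Flat R P] :
    Cotensor R D (Cotensor R C M N) P ≃ₗ[R] Cotensor R C M (Cotensor R D N P) :=
  LinearEquiv.ofInjective _ (Cotensor.inclLeft_injective R C D M N P) ≪≫ₗ
    LinearEquiv.ofEq _ _ ((Cotensor.range_inclLeft R C D M N P).trans
      (Cotensor.range_inclRight R C D M N P).symm) ≪≫ₗ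
    (LinearEquiv.ofInjective _ (Cotensor.inclRight_injective R C D M N P)).symm

theorem Cotensor.inclRight_assoc [Module.Flat R M] [Module.Flat R P]
    (t : Cotensor R D (Cotensor R C M N) P) :
    Cotensor.inclRight R C D M N P (Cotensor.assoc R C D M N P t) =
      Cotensor.inclLeft R C D M N P t := by
  have h := (LinearEquiv.ofInjective _
    (Cotensor.inclRight_injective R C D M N P)).apply_symm_apply
      ((LinearEquiv.ofEq _ _ ((Cotensor.range_inclLeft R C D M N P).trans
        (Cotensor.range_inclRight R C D M N P).symm))
        (LinearEquiv.ofInjective _ (Cotensor.inclLeft_injective R C D M N P) t))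
  exact congrArg Subtype.val h

end Assoc

/-! ### Morita–Takeuchi contexts -/

section Context

variable (R : Type u) [CommRing R]
  (D : Type u) [AddCommGroup D] [Module R D] [Coalgebra R D] [Module.Flat R D]
  (C : Type u) [AddCommGroup C] [Module R C] [Coalgebra R C] [Module.Flat R C]

/-- A Morita–Takeuchi context `(D, C, M, N, f, g)` over the flat `R`-coalgebras `D` and `C`. -/
structure MoritaTakeuchiContext where
  /-- the `D`-`C`-bicomodule `M` -/
  M : Type u
  [addCommGroupM : AddCommGroup M]
  [moduleM : Module R M]
  [leftM : LeftComodule R D M]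
  [rightM : RightComodule R C M]
  [bicomoduleM : IsBicomodule R D C M]
  /-- the `C`-`D`-bicomodule `N` -/
  N : Type u
  [addCommGroupN : AddCommGroup N]
  [moduleN : Module R N]
  [leftN : LeftComodule R C N]
  [rightN : RightComodule R D N]
  [bicomoduleN : IsBicomodule R C D N]
  [flatM : Module.Flat R M]
  [flatN : Module.Flat R N]
  pureMN : IsPure (Cotensor R C M N)
  pureNM : IsPure (Cotensor R D N M)
  /-- the bicomodule morphism `f : D → M □_C N` -/
  f : D →ₗ[R] Cotensor R C M N
  f_left : IsLeftColinear R D f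
  f_right : IsRightColinear R D f
  /-- the bicomodule morphism `g : C → N □_D M` -/
  g : C →ₗ[R] Cotensor R D N M
  g_left : IsLeftColinear R C g
  g_right : IsRightColinear R C g
  /-- the square `M ≅ M □ C → M □ N □ M ← D □ M ≅ M` -/
  diagramM : ∀ m : M,
    Cotensor.mapRight M g g_left (Cotensor.rightUnit R C M m) =
      Cotensor.assoc R C D M N M (Cotensor.mapLeft M f f_right (Cotensor.leftUnit R D M m))
  /-- the square `N ≅ N □ D → N □ M □ N ← C □ N ≅ N` -/
  diagramN : ∀ n : N,
    Cotensor.mapRight N f f_left (Cotensor.rightUnit R D N n) =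
      Cotensor.assoc R D C N M N (Cotensor.mapLeft N g g_right (Cotensor.leftUnit R C N n))

variable {R D C} in
/-- A Morita–Takeuchi context is strict if `f` and `g` are bijective. -/
def MoritaTakeuchiContext.IsStrict (K : MoritaTakeuchiContext R D C) : Prop :=
  Function.Bijective K.f ∧ Function.Bijective K.g

end Context

end MoritaTakeuchi

/-!
Given a strict context, the equivalence is given by the functors `- □_C N` and `- □_D M`, with unit
`v ↦ v₀ ⊗ g(v₁)`, which is injective because `g` is bijective and `N □_D M` is pure. For `t` in
`(V □_C N) □_D M`, the two squares of the context show that applying the unit to the `V`-part of `t`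
gives the same element as applying `g` to the coaction of `t`. So the coaction of `t` vanishes
modulo the image of the unit, hence by the counit so does `t`.

Conversely, `X ⊗ V` represents the linear maps from the module `X` to the modules `Hom(V, -)`, so a
linear equivalence `F : 𝓜^C ⥤ 𝓜^D` commutes with `X ⊗ -`. Applying `F` to the equalizer
`V → V ⊗ C ⇉ V ⊗ C ⊗ C` gives `F(V) ≅ V □_C F(C)`. With an inverse `G`, put `M = G(D)`, `N = F(C)`
and `f : D ≅ F(G(D)) ≅ G(D) □_C F(C)`, and similarly for `g`; the squares of the context come from
the triangle identities.
-/

namespace MoritaTakeuchi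

set_option maxSynthPendingDepth 3

/-! ### Colinear maps -/

theorem rTensor_lTensor_comm {R : Type u} [CommRing R]
    {V : Type v} [AddCommGroup V] [Module R V] {W : Type w} [AddCommGroup W] [Module R W]
    {X : Type x} [AddCommGroup X] [Module R X] {Y : Type y} [AddCommGroup Y] [Module R Y]
    (f : V →ₗ[R] W) (g : X →ₗ[R] Y) (t : V ⊗[R] X) :
    f.rTensor Y (g.lTensor V t) = g.lTensor W (f.rTensor X t) := by
  rw [← LinearMap.comp_apply, LinearMap.rTensor_comp_lTensor, ← LinearMap.lTensor_comp_rTensor,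
    LinearMap.comp_apply]

section Colinear

variable {R : Type u} [CommRing R] {C : Type v} [AddCommGroup C] [Module R C] [Coalgebra R C]
  {V : Type w} [AddCommGroup V] [Module R V]
  {W : Type x} [AddCommGroup W] [Module R W]
  {X : Type y} [AddCommGroup X] [Module R X]

theorem IsRightColinear.comp [RightComodule R C V] [RightComodule R C W] [RightComodule R C X]
    {g : W →ₗ[R] X} {f : V →ₗ[R] W} (hg : IsRightColinear R C g) (hf : IsRightColinear R C f) :
    IsRightColinear R C (g ∘ₗ f) := by
  unfold IsRightColinear at *
  rw [LinearMap.rTensor_comp, ← LinearMap.comp_assoc, hg, LinearMap.comp_assoc, hf,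
    LinearMap.comp_assoc]

theorem IsLeftColinear.comp [LeftComodule R C V] [LeftComodule R C W] [LeftComodule R C X]
    {g : W →ₗ[R] X} {f : V →ₗ[R] W} (hg : IsLeftColinear R C g) (hf : IsLeftColinear R C f) :
    IsLeftColinear R C (g ∘ₗ f) := by
  unfold IsLeftColinear at *
  rw [LinearMap.lTensor_comp, ← LinearMap.comp_assoc, hg, LinearMap.comp_assoc, hf,
    LinearMap.comp_assoc]

theorem IsRightColinear.of_comp [RightComodule R C V] [RightComodule R C W] [RightComodule R C X]
    {g : W →ₗ[R] X} {f : V →ₗ[R] W} (hg : IsRightColinear R C g)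
    (hinj : Function.Injective (g.rTensor C)) (hgf : IsRightColinear R C (g ∘ₗ f)) :
    IsRightColinear R C f := by
  unfold IsRightColinear at *
  rw [LinearMap.rTensor_comp, ← LinearMap.comp_assoc, hg, LinearMap.comp_assoc,
    LinearMap.comp_assoc] at hgf
  exact (LinearMap.cancel_left hinj).1 hgf

theorem IsLeftColinear.of_comp [LeftComodule R C V] [LeftComodule R C W] [LeftComodule R C X]
    {g : W →ₗ[R] X} {f : V →ₗ[R] W} (hg : IsLeftColinear R C g)
    (hinj : Function.Injective (g.lTensor C)) (hgf : IsLeftColinear R C (g ∘ₗ f)) :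
    IsLeftColinear R C f := by
  unfold IsLeftColinear at *
  rw [LinearMap.lTensor_comp, ← LinearMap.comp_assoc, hg, LinearMap.comp_assoc,
    LinearMap.comp_assoc] at hgf
  exact (LinearMap.cancel_left hinj).1 hgf

theorem isRightColinear_id [RightComodule R C V] :
    IsRightColinear R C (LinearMap.id : V →ₗ[R] V) := by
  rw [IsRightColinear, LinearMap.rTensor_id, LinearMap.comp_id, LinearMap.id_comp]

theorem isRightColinear_mk [RightComodule R C V] (x : X) :
    IsRightColinear R C (TensorProduct.mk R X V x) :=
  tensorRight_aux R C X V (rcoact R C V) x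

theorem isRightColinear_of_comp_mk [RightComodule R C V] [RightComodule R C W]
    {h : X ⊗[R] V →ₗ[R] W} (hh : ∀ x, IsRightColinear R C (h ∘ₗ TensorProduct.mk R X V x)) :
    IsRightColinear R C h := by
  refine TensorProduct.ext (LinearMap.ext fun x => ?_)
  change (rcoact R C W ∘ₗ h) ∘ₗ TensorProduct.mk R X V x =
    (h.rTensor C ∘ₗ rcoact R C (X ⊗[R] V)) ∘ₗ TensorProduct.mk R X V x
  rw [LinearMap.comp_assoc, hh x, LinearMap.rTensor_comp, LinearMap.comp_assoc,
    LinearMap.comp_assoc, isRightColinear_mk x]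

theorem isRightColinear_rTensor [RightComodule R C V] (h : X →ₗ[R] W) :
    IsRightColinear R C (h.rTensor V) :=
  isRightColinear_of_comp_mk fun x => isRightColinear_mk (h x)

theorem IsRightColinear.lTensor [RightComodule R C V] [RightComodule R C W] {h : V →ₗ[R] W}
    (hh : IsRightColinear R C h) : IsRightColinear R C (h.lTensor X) :=
  isRightColinear_of_comp_mk fun x => (isRightColinear_mk x).comp hh

theorem isRightColinear_assoc [RightComodule R C V] :
    IsRightColinear R C (TensorProduct.assoc R X W V).toLinearMap := by
  refine isRightColinear_of_comp_mk fun t => ?_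
  induction t with
  | zero => simp [IsRightColinear]
  | add a b ha hb =>
    unfold IsRightColinear at *
    rw [map_add, LinearMap.comp_add, LinearMap.comp_add, ha, hb, LinearMap.rTensor_add,
      LinearMap.add_comp]
  | tmul x w => exact (isRightColinear_mk x).comp (isRightColinear_mk w)

theorem IsRightColinear.symm [RightComodule R C V] [RightComodule R C W] {e : V ≃ₗ[R] W}
    (he : IsRightColinear R C e.toLinearMap) : IsRightColinear R C e.symm.toLinearMap := by
  refine he.of_comp (e.rTensor C).injective ?_
  rw [LinearEquiv.comp_symm]
  exact isRightColinear_id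

theorem isRightColinear_rcoact [RightComodule R C V] : IsRightColinear R C (rcoact R C V) := by
  change (TensorProduct.assoc R V C C).symm.toLinearMap ∘ₗ
    ((rcoact R C C).lTensor V ∘ₗ rcoact R C V) = _
  rw [LinearEquiv.toLinearMap_symm_comp_eq]
  exact RightComodule.coassoc.symm

theorem rid_comp_lTensor_counit_comp_rTensor_comp_rcoact [RightComodule R C V] (p : V →ₗ[R] X) :
    (TensorProduct.rid R X).toLinearMap ∘ₗ (Coalgebra.counit (R := R) (A := C)).lTensor X ∘ₗ
      p.rTensor C ∘ₗ rcoact R C V = p := by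
  have rid_naturality : (TensorProduct.rid R X).toLinearMap ∘ₗ p.rTensor R =
      p ∘ₗ (TensorProduct.rid R V).toLinearMap := by
    ext; simp
  rw [← LinearMap.comp_assoc _ (p.rTensor C), LinearMap.lTensor_comp_rTensor,
    ← LinearMap.rTensor_comp_lTensor, LinearMap.comp_assoc, ← LinearMap.comp_assoc, rid_naturality,
    LinearMap.comp_assoc, RightComodule.counit_coact, LinearMap.comp_id]

variable (C) in
theorem eq_zero_of_rTensor_rcoact_eq_zero [RightComodule R C V] (p : V →ₗ[R] X) {v : V}
    (h : p.rTensor C (rcoact R C V v) = 0) : p v = 0 := by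
  rw [← LinearMap.congr_fun (rid_comp_lTensor_counit_comp_rTensor_comp_rcoact (C := C) p) v]
  simp only [LinearMap.comp_apply, h, map_zero]

theorem rcoact_injective [RightComodule R C V] : Function.Injective (rcoact R C V) := by
  refine (injective_iff_map_eq_zero _).2 fun v hv => ?_
  exact eq_zero_of_rTensor_rcoact_eq_zero C LinearMap.id (by rw [hv, map_zero])

theorem mem_range_of_rTensor_eq_lTensor_rcoact [RightComodule R C W] {Y : Type z} [AddCommGroup Y]
    [Module R Y] {f : V →ₗ[R] W} {g : C →ₗ[R] Y}
    (hg : Function.Injective (g.lTensor (W ⧸ LinearMap.range f))) {s : V ⊗[R] Y} {w : W}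
    (h : f.rTensor Y s = g.lTensor W (rcoact R C W w)) : w ∈ LinearMap.range f := by
  let p := (LinearMap.range f).mkQ
  have hp : p.rTensor Y (f.rTensor Y s) = 0 := by
    rw [← LinearMap.comp_apply, ← LinearMap.rTensor_comp, LinearMap.range_mkQ_comp,
      LinearMap.rTensor_zero, LinearMap.zero_apply]
  rw [h, rTensor_lTensor_comm] at hp
  have hw : p w = 0 :=
    eq_zero_of_rTensor_rcoact_eq_zero C p ((injective_iff_map_eq_zero _).1 hg _ hp)
  exact (Submodule.Quotient.mk_eq_zero _).1 hw

theorem mem_cotensor_iff [RightComodule R C V] [LeftComodule R C W] {t : V ⊗[R] W} :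
    t ∈ Cotensor R C V W ↔
      TensorProduct.assoc R V C W ((rcoact R C V).rTensor W t) = (lcoact R C W).lTensor V t :=
  sub_eq_zero

theorem isRightColinear_inclLeft {D : Type z} [AddCommGroup D] [Module R D] [Coalgebra R D]
    [Module.Flat R C] [Module.Flat R D] [RightComodule R D V]
    [LeftComodule R D W] [RightComodule R C W] [IsBicomodule R D C W]
    [LeftComodule R C X] [RightComodule R D X] [IsBicomodule R C D X] :
    IsRightColinear R D (Cotensor.inclLeft R D C V W X) :=
  isRightColinear_assoc.comp ((isRightColinear_rTensor _).comp cotensor_subtype_rightColinear)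

end Colinear

/-! ### Cotensor functors -/

section CotensorFunctor

variable {R : Type u} [CommRing R] {C : Type v} [AddCommGroup C] [Module R C] [Coalgebra R C]
  {D : Type y} [AddCommGroup D] [Module R D] [Coalgebra R D] [Module.Flat R D]
  {V : Type w} [AddCommGroup V] [Module R V] [RightComodule R C V]
  {W : Type x} [AddCommGroup W] [Module R W] [RightComodule R C W]
  (N : Type z) [AddCommGroup N] [Module R N] [LeftComodule R C N] [RightComodule R D N]
  [IsBicomodule R C D N]

theorem isRightColinear_mapLeft {h : V →ₗ[R] W} (hh : IsRightColinear R C h) :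
    IsRightColinear R D (Cotensor.mapLeft N h hh) :=
  cotensor_subtype_rightColinear.of_comp (rTensor_subtype_injective D _) <|
    (isRightColinear_rTensor h).comp cotensor_subtype_rightColinear

theorem inclLeft_mapLeft_mapLeft [Module.Flat R C] (P : Type*) [AddCommGroup P] [Module R P]
    [LeftComodule R D P] {h : V →ₗ[R] W} (hh : IsRightColinear R C h)
    (t : Cotensor R D (Cotensor R C V N) P) :
    Cotensor.inclLeft R C D W N P
        (Cotensor.mapLeft P (Cotensor.mapLeft N h hh) (isRightColinear_mapLeft N hh) t) =
      h.rTensor (N ⊗[R] P) (Cotensor.inclLeft R C D V N P t) := by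
  have subtype_comp_mapLeft : (Cotensor R C W N).subtype ∘ₗ Cotensor.mapLeft N h hh =
      h.rTensor N ∘ₗ (Cotensor R C V N).subtype := rfl
  change (TensorProduct.assoc R W N P).toLinearMap
      ((Cotensor R C W N).subtype.rTensor P ((Cotensor.mapLeft N h hh).rTensor P t.1)) =
    h.rTensor (N ⊗[R] P) (TensorProduct.assoc R V N P
      ((Cotensor R C V N).subtype.rTensor P t.1))
  rw [← LinearMap.comp_apply (LinearMap.rTensor P _), ← LinearMap.rTensor_comp,
    subtype_comp_mapLeft, LinearMap.rTensor_comp, LinearMap.rTensor_tensor]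
  simp

end CotensorFunctor

section CotensorCat

variable {R : Type u} [CommRing R] {C : Type u} [AddCommGroup C] [Module R C] [Coalgebra R C]
  {D : Type u} [AddCommGroup D] [Module R D] [Coalgebra R D] [Module.Flat R D]

/-- The functor `- □_C N : 𝓜^C ⥤ 𝓜^D` given by a `C`-`D`-bicomodule `N`. -/
noncomputable def cotensorFunctor (N : Type u) [AddCommGroup N] [Module R N] [LeftComodule R C N]
    [RightComodule R D N] [IsBicomodule R C D N] : RightComodCat R C ⥤ RightComodCat R D where
  obj V := ⟨Cotensor R C V.carrier N⟩
  map h := ⟨Cotensor.mapLeft N h.1 h.2, isRightColinear_mapLeft N h.2⟩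
  map_id V := Subtype.ext <| LinearMap.ext fun t => Subtype.ext <|
    LinearMap.congr_fun (LinearMap.rTensor_id N V.carrier) t.1
  map_comp f g := Subtype.ext <| LinearMap.ext fun t => Subtype.ext <|
    LinearMap.congr_fun (LinearMap.rTensor_comp N g.1 f.1) t.1

variable (N : Type u) [AddCommGroup N] [Module R N] [LeftComodule R C N] [RightComodule R D N]
  [IsBicomodule R C D N]

instance : (cotensorFunctor (R := R) (C := C) (D := D) N).Additive where
  map_add {_ _ f g} := Subtype.ext <| LinearMap.ext fun t => Subtype.ext <|
    LinearMap.congr_fun (LinearMap.rTensor_add N f.1 g.1) t.1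

instance : (cotensorFunctor (R := R) (C := C) (D := D) N).Linear R where
  map_smul f r := Subtype.ext <| LinearMap.ext fun t => Subtype.ext <|
    LinearMap.congr_fun (LinearMap.rTensor_smul N r f.1) t.1

/-- A bijective colinear map as an isomorphism in `𝓜^C`. -/
noncomputable def RightComodCat.isoOfBijective {V W : RightComodCat R C} (f : V ⟶ W)
    (hf : Function.Bijective f.1) : V ≅ W where
  hom := f
  inv := ⟨(LinearEquiv.ofBijective f.1 hf).symm.toLinearMap,
    IsRightColinear.symm (e := LinearEquiv.ofBijective f.1 hf) f.2⟩
  hom_inv_id := Subtype.ext <| LinearMap.ext fun v =>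
    (LinearEquiv.ofBijective f.1 hf).symm_apply_apply v
  inv_hom_id := Subtype.ext <| LinearMap.ext fun v =>
    (LinearEquiv.ofBijective f.1 hf).apply_symm_apply v

end CotensorCat

/-! ### The equivalence given by a strict context -/

namespace MoritaTakeuchiContext

attribute [instance] addCommGroupM moduleM leftM rightM bicomoduleM addCommGroupN moduleN leftN
  rightN bicomoduleN flatM flatN

variable {R : Type u} [CommRing R]
  {D : Type u} [AddCommGroup D] [Module R D] [Coalgebra R D] [Module.Flat R D]
  {C : Type u} [AddCommGroup C] [Module R C] [Coalgebra R C] [Module.Flat R C]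
  (K : MoritaTakeuchiContext R D C)

/-- The context `(C, D, N, M, g, f)` with the two sides interchanged. -/
def swap : MoritaTakeuchiContext R C D where
  M := K.N
  N := K.M
  pureMN := K.pureNM
  pureNM := K.pureMN
  f := K.g
  f_left := K.g_left
  f_right := K.g_right
  g := K.f
  g_left := K.f_left
  g_right := K.f_right
  diagramM := K.diagramN
  diagramN := K.diagramM

/-- The map `f` with values in `M ⊗ N`. -/
def fTensor : D →ₗ[R] K.M ⊗[R] K.N := (Cotensor R C K.M K.N).subtype ∘ₗ K.f

/-- The map `g` with values in `N ⊗ M`. -/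
def gTensor : C →ₗ[R] K.N ⊗[R] K.M := (Cotensor R D K.N K.M).subtype ∘ₗ K.g

theorem isLeftColinear_gTensor : IsLeftColinear R C K.gTensor :=
  cotensor_subtype_leftColinear.comp K.g_left

theorem isRightColinear_gTensor : IsRightColinear R C K.gTensor :=
  cotensor_subtype_rightColinear.comp K.g_right

theorem lTensor_gTensor_comp_rcoact :
    K.gTensor.lTensor K.M ∘ₗ rcoact R C K.M =
      (TensorProduct.assoc R K.M K.N K.M).toLinearMap ∘ₗ
        K.fTensor.rTensor K.M ∘ₗ lcoact R D K.M := by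
  refine LinearMap.ext fun m => ?_
  have square := congrArg (Cotensor.inclRight R C D K.M K.N K.M) (K.diagramM m)
  rw [Cotensor.inclRight_assoc] at square
  rw [gTensor, fTensor, LinearMap.lTensor_comp, LinearMap.rTensor_comp]
  exact square

theorem lTensor_fTensor_comp_rcoact :
    K.fTensor.lTensor K.N ∘ₗ rcoact R D K.N =
      (TensorProduct.assoc R K.N K.M K.N).toLinearMap ∘ₗ
        K.gTensor.rTensor K.N ∘ₗ lcoact R C K.N :=
  K.swap.lTensor_gTensor_comp_rcoact

/-- The map `n ⊗ d ⊗ m ↦ n ⊗ f(d) ⊗ m`, through which both coactions of `N ⊗ M` factor after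
applying `g`. -/
noncomputable def insertF : K.N ⊗[R] (D ⊗[R] K.M) →ₗ[R] (K.N ⊗[R] K.M) ⊗[R] (K.N ⊗[R] K.M) :=
  (TensorProduct.assoc R K.N K.M (K.N ⊗[R] K.M)).symm.toLinearMap ∘ₗ
    ((TensorProduct.assoc R K.M K.N K.M).toLinearMap ∘ₗ K.fTensor.rTensor K.M).lTensor K.N

theorem insertF_comp_assoc :
    K.insertF ∘ₗ (TensorProduct.assoc R K.N D K.M).toLinearMap =
      (TensorProduct.assoc R (K.N ⊗[R] K.M) K.N K.M).toLinearMap ∘ₗ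
        ((TensorProduct.assoc R K.N K.M K.N).symm.toLinearMap ∘ₗ
          K.fTensor.lTensor K.N).rTensor K.M := by
  refine TensorProduct.ext_threefold fun n d m => ?_
  simp only [insertF, LinearMap.comp_apply, LinearEquiv.coe_coe, TensorProduct.assoc_tmul,
    LinearMap.lTensor_tmul, LinearMap.rTensor_tmul]
  induction K.fTensor d with
  | zero => simp
  | add s t hs ht => simp only [TensorProduct.add_tmul, TensorProduct.tmul_add, map_add, hs, ht]
  | tmul m' n' => simp

theorem lTensor_gTensor_comp_rcoact_tensor :
    K.gTensor.lTensor (K.N ⊗[R] K.M) ∘ₗ rcoact R C (K.N ⊗[R] K.M) =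
      K.insertF ∘ₗ (lcoact R D K.M).lTensor K.N := by
  change _ ∘ₗ (TensorProduct.assoc R K.N K.M C).symm.toLinearMap ∘ₗ
    (rcoact R C K.M).lTensor K.N = _
  rw [LinearMap.lTensor_tensor, insertF, LinearMap.comp_assoc, LinearMap.comp_assoc,
    LinearMap.comp_assoc, ← LinearMap.comp_assoc (LinearMap.lTensor _ (rcoact _ _ _)),
    LinearEquiv.comp_symm, LinearMap.id_comp, ← LinearMap.lTensor_comp, ← LinearMap.lTensor_comp,
    lTensor_gTensor_comp_rcoact, LinearMap.comp_assoc]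

theorem rTensor_gTensor_comp_lcoact_tensor :
    K.gTensor.rTensor (K.N ⊗[R] K.M) ∘ₗ lcoact R C (K.N ⊗[R] K.M) =
      K.insertF ∘ₗ (TensorProduct.assoc R K.N D K.M).toLinearMap ∘ₗ
        (rcoact R D K.N).rTensor K.M := by
  change _ ∘ₗ (TensorProduct.assoc R C K.N K.M).toLinearMap ∘ₗ (lcoact R C K.N).rTensor K.M = _
  rw [LinearMap.rTensor_tensor, ← LinearMap.comp_assoc (LinearMap.rTensor _ (rcoact _ _ _)),
    insertF_comp_assoc, LinearMap.comp_assoc, LinearMap.comp_assoc, LinearMap.comp_assoc,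
    ← LinearMap.comp_assoc (LinearMap.rTensor _ (lcoact _ _ _)), LinearEquiv.symm_comp,
    LinearMap.id_comp, ← LinearMap.rTensor_comp, ← LinearMap.rTensor_comp, LinearMap.comp_assoc,
    lTensor_fTensor_comp_rcoact, ← LinearMap.comp_assoc _ _ (LinearEquiv.toLinearMap _),
    LinearEquiv.symm_comp, LinearMap.id_comp]

theorem rTensor_gTensor_comp_lcoact_sub :
    K.gTensor.rTensor (K.N ⊗[R] K.M) ∘ₗ lcoact R C (K.N ⊗[R] K.M) -
        K.gTensor.lTensor (K.N ⊗[R] K.M) ∘ₗ rcoact R C (K.N ⊗[R] K.M) =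
      K.insertF ∘ₗ cotensorMap R D K.N K.M := by
  rw [K.rTensor_gTensor_comp_lcoact_tensor, K.lTensor_gTensor_comp_rcoact_tensor, cotensorMap,
    LinearMap.comp_sub]

section Unit

variable (V : Type v) [AddCommGroup V] [Module R V] [RightComodule R C V]

/-- The map `V → V ⊗ N ⊗ M`, `v ↦ v₀ ⊗ g(v₁)`. -/
noncomputable def unitTensor : V →ₗ[R] V ⊗[R] (K.N ⊗[R] K.M) :=
  K.gTensor.lTensor V ∘ₗ rcoact R C V

theorem isRightColinear_unitTensor : IsRightColinear R C (K.unitTensor V) :=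
  K.isRightColinear_gTensor.lTensor.comp isRightColinear_rcoact

theorem unitTensor_mem_range_inclLeft (v : V) :
    K.unitTensor V v ∈ LinearMap.range (Cotensor.inclLeft R C D V K.N K.M) := by
  have cotensorMap_comp_gTensor : cotensorMap R D K.N K.M ∘ₗ K.gTensor = 0 :=
    LinearMap.ext fun c => (K.g c).2
  rw [Cotensor.range_inclLeft]
  constructor
  · exact (Cotensor.mapRight V K.gTensor K.isLeftColinear_gTensor (Cotensor.rightUnit R C V v)).2
  · rw [SetLike.mem_coe, LinearMap.mem_ker, unitTensor, ← LinearMap.comp_apply,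
      ← LinearMap.comp_assoc, ← LinearMap.lTensor_comp, cotensorMap_comp_gTensor,
      LinearMap.lTensor_zero, LinearMap.zero_comp, LinearMap.zero_apply]

/-- The unit `V → (V □_C N) □_D M` of the equivalence, obtained from `unitTensor` by restricting
the codomain. -/
noncomputable def unit : V →ₗ[R] Cotensor R D (Cotensor R C V K.N) K.M :=
  (LinearEquiv.ofInjective _ (Cotensor.inclLeft_injective R C D V K.N K.M)).symm.toLinearMap ∘ₗ
    (K.unitTensor V).codRestrict _ (K.unitTensor_mem_range_inclLeft V)

theorem inclLeft_comp_unit :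
    Cotensor.inclLeft R C D V K.N K.M ∘ₗ K.unit V = K.unitTensor V :=
  LinearMap.ext fun _ => congrArg Subtype.val <| (LinearEquiv.ofInjective _
    (Cotensor.inclLeft_injective R C D V K.N K.M)).apply_symm_apply _

theorem rTensor_inclLeft_injective (Q : Type w) [AddCommGroup Q] [Module R Q] [Module.Flat R Q] :
    Function.Injective ((Cotensor.inclLeft R C D V K.N K.M).rTensor Q) :=
  Module.Flat.rTensor_preserves_injective_linearMap _ (Cotensor.inclLeft_injective ..)

theorem isRightColinear_unit : IsRightColinear R C (K.unit V) := by
  refine isRightColinear_inclLeft.of_comp (K.rTensor_inclLeft_injective V C) ?_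
  rw [inclLeft_comp_unit]
  exact K.isRightColinear_unitTensor V

theorem unit_naturality {V : Type v} [AddCommGroup V] [Module R V] [RightComodule R C V]
    {W : Type w} [AddCommGroup W] [Module R W] [RightComodule R C W] {h : V →ₗ[R] W}
    (hh : IsRightColinear R C h) (v : V) :
    K.unit W (h v) = Cotensor.mapLeft K.M (Cotensor.mapLeft K.N h hh)
      (isRightColinear_mapLeft K.N hh) (K.unit V v) := by
  refine Cotensor.inclLeft_injective R C D W K.N K.M ?_
  rw [inclLeft_mapLeft_mapLeft, ← LinearMap.comp_apply, ← LinearMap.comp_apply (g := K.unit V),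
    inclLeft_comp_unit, inclLeft_comp_unit, unitTensor, unitTensor, LinearMap.comp_apply,
    LinearMap.comp_apply, rTensor_lTensor_comm]
  exact congrArg _ (LinearMap.congr_fun hh v)

/-- On `V ⊗ N ⊗ M`, the two squares of the context move the coaction of `V` across to the one of
`M`: `v₀ ⊗ g(v₁) ⊗ n ⊗ m = v ⊗ g(n₋₁) ⊗ n₀ ⊗ m = v ⊗ n₀ ⊗ f(n₁) ⊗ m = v ⊗ n ⊗ f(m₋₁) ⊗ m₀
= v ⊗ n ⊗ m₀ ⊗ g(m₁)`. -/
theorem rTensor_unitTensor {s : V ⊗[R] (K.N ⊗[R] K.M)}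
    (hVN : s ∈ Cotensor R C V (K.N ⊗[R] K.M))
    (hNM : s ∈ LinearMap.ker ((cotensorMap R D K.N K.M).lTensor V)) :
    (K.unitTensor V).rTensor (K.N ⊗[R] K.M) s =
      K.gTensor.lTensor (V ⊗[R] (K.N ⊗[R] K.M)) (rcoact R C (V ⊗[R] (K.N ⊗[R] K.M)) s) := by
  let P := K.N ⊗[R] K.M
  have move_V : (rcoact R C V).rTensor P s =
      (TensorProduct.assoc R V C P).symm ((lcoact R C P).lTensor V s) := by
    rw [LinearEquiv.eq_symm_apply, mem_cotensor_iff.1 hVN]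
  have move_NM : (K.gTensor.rTensor P ∘ₗ lcoact R C P).lTensor V s =
      (K.gTensor.lTensor P ∘ₗ rcoact R C P).lTensor V s := by
    rw [← sub_eq_zero, ← LinearMap.sub_apply, ← LinearMap.lTensor_sub,
      rTensor_gTensor_comp_lcoact_sub, LinearMap.lTensor_comp, LinearMap.comp_apply,
      LinearMap.mem_ker.1 hNM, map_zero]
  calc (K.unitTensor V).rTensor P s
      = (K.gTensor.lTensor V).rTensor P ((rcoact R C V).rTensor P s) := by
        rw [unitTensor, LinearMap.rTensor_comp, LinearMap.comp_apply]
    _ = (TensorProduct.assoc R V P P).symm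
          ((K.gTensor.rTensor P ∘ₗ lcoact R C P).lTensor V s) := by
        rw [move_V, LinearMap.lTensor_comp]
        exact LinearMap.congr_fun (LinearMap.rTensor_lTensor_comp_assoc_symm C K.gTensor) _
    _ = K.gTensor.lTensor (V ⊗[R] P) (rcoact R C (V ⊗[R] P) s) := by
        rw [move_NM, LinearMap.lTensor_comp, LinearMap.lTensor_tensor V]
        exact congrArg (fun q => (TensorProduct.assoc R V P P).symm
          ((K.gTensor.lTensor P).lTensor V q)) (LinearEquiv.apply_symm_apply _ _).symm

theorem rTensor_unit (t : Cotensor R D (Cotensor R C V K.N) K.M) :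
    (K.unit V).rTensor (K.N ⊗[R] K.M) (Cotensor.inclLeft R C D V K.N K.M t) =
      K.gTensor.lTensor _ (rcoact R C (Cotensor R D (Cotensor R C V K.N) K.M) t) := by
  let i := Cotensor.inclLeft R C D V K.N K.M
  have hi : i t ∈ LinearMap.range i := ⟨t, rfl⟩
  rw [Cotensor.range_inclLeft] at hi
  refine K.rTensor_inclLeft_injective V (K.N ⊗[R] K.M) ?_
  rw [← LinearMap.comp_apply, ← LinearMap.rTensor_comp, inclLeft_comp_unit,
    K.rTensor_unitTensor V hi.1 hi.2, rTensor_lTensor_comm]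
  exact congrArg _ (LinearMap.congr_fun isRightColinear_inclLeft t)

end Unit

section Strict

variable {K}

theorem lTensor_gTensor_injective (hg : Function.Bijective K.g) (Q : Type u) [AddCommGroup Q]
    [Module R Q] : Function.Injective (K.gTensor.lTensor Q) := by
  rw [gTensor, LinearMap.lTensor_comp, LinearMap.coe_comp]
  refine Function.Injective.comp ?_ ((LinearEquiv.ofBijective K.g hg).lTensor Q).injective
  exact (LinearMap.lTensor_inj_iff_rTensor_inj Q _).2 (K.pureNM Q)

theorem unit_bijective (hg : Function.Bijective K.g) (V : Type u) [AddCommGroup V] [Module R V]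
    [RightComodule R C V] : Function.Bijective (K.unit V) := by
  constructor
  · have unitTensor_injective : Function.Injective (K.unitTensor V) :=
      (lTensor_gTensor_injective hg V).comp rcoact_injective
    rw [← inclLeft_comp_unit, LinearMap.coe_comp] at unitTensor_injective
    exact unitTensor_injective.of_comp
  · exact fun t => mem_range_of_rTensor_eq_lTensor_rcoact (lTensor_gTensor_injective hg _)
      (K.rTensor_unit V t)

/-- The natural isomorphism `V ≅ (V □_C N) □_D M`. -/
noncomputable def unitIso (hg : Function.Bijective K.g) :
    𝟭 (RightComodCat R C) ≅ cotensorFunctor (D := D) K.N ⋙ cotensorFunctor (D := C) K.M :=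
  NatIso.ofComponents
    (fun V => RightComodCat.isoOfBijective
      (W := (cotensorFunctor (D := D) K.N ⋙ cotensorFunctor (D := C) K.M).obj V)
      ⟨K.unit V.carrier, K.isRightColinear_unit V.carrier⟩ (unit_bijective hg V.carrier))
    fun h => Subtype.ext (LinearMap.ext (K.unit_naturality h.2))

end Strict

theorem IsStrict.moritaTakeuchiEquivalent {K : MoritaTakeuchiContext R D C} (hK : K.IsStrict) :
    MoritaTakeuchiEquivalent R C D :=
  ⟨CategoryTheory.Equivalence.mk (cotensorFunctor K.N) (cotensorFunctor K.M) (unitIso hK.2)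
    (unitIso (K := K.swap) hK.1).symm,
    inferInstanceAs (cotensorFunctor (R := R) (C := C) (D := D) K.N).Additive,
    inferInstanceAs ((cotensorFunctor (R := R) (C := C) (D := D) K.N).Linear R)⟩

end MoritaTakeuchiContext

/-! ### Tensoring comodules with modules -/

namespace RightComodCat

variable {R : Type u} [CommRing R] {C : Type u} [AddCommGroup C] [Module R C] [Coalgebra R C]

variable (R C) in
/-- The coalgebra `C` as an object of `𝓜^C`. -/
abbrev reg : RightComodCat R C := ⟨C⟩

/-- The comodule `X ⊗ V`, for an `R`-module `X` and a comodule `V`. -/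
abbrev tensor (X : Type u) [AddCommGroup X] [Module R X] (V : RightComodCat R C) :
    RightComodCat R C := ⟨X ⊗[R] V.carrier⟩

variable {X : Type u} [AddCommGroup X] [Module R X] {Y : Type u} [AddCommGroup Y] [Module R Y]
  {V W : RightComodCat R C}

theorem hom_ext {f g : V ⟶ W} (h : ∀ v, f.1 v = g.1 v) : f = g :=
  Subtype.ext (LinearMap.ext h)

theorem congr_hom {f g : V ⟶ W} (h : f = g) (v : V.carrier) : f.1 v = g.1 v := by rw [h]

variable (V) in
/-- The morphisms `V → X ⊗ V`, `v ↦ x ⊗ v`, depending linearly on `x`. They make `X ⊗ V` represent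
the linear maps from `X` to the modules `Hom(V, W)`. -/
def tmulHom : X →ₗ[R] (V ⟶ tensor X V) where
  toFun x := ⟨TensorProduct.mk R X V.carrier x, isRightColinear_mk x⟩
  map_add' _ _ := Subtype.ext (map_add _ _ _)
  map_smul' _ _ := Subtype.ext (map_smul _ _ _)

/-- The morphism `X ⊗ V → W` given by a linear family of morphisms `V → W`. -/
def tensorLift (p : X →ₗ[R] (V ⟶ W)) : tensor X V ⟶ W :=
  ⟨TensorProduct.lift ((comHom R C V.carrier W.carrier).subtype ∘ₗ p),
    isRightColinear_of_comp_mk fun x => (p x).2⟩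

theorem tmulHom_tensorLift (p : X →ₗ[R] (V ⟶ W)) (x : X) : tmulHom V x ≫ tensorLift p = p x :=
  hom_ext fun _ => rfl

theorem tensor_hom_ext {f g : tensor X V ⟶ W} (h : ∀ x : X, tmulHom V x ≫ f = tmulHom V x ≫ g) :
    f = g :=
  Subtype.ext (TensorProduct.ext' fun x v => congr_hom (h x) v)

variable (V) in
/-- The morphism `h ⊗ id : X ⊗ V → Y ⊗ V`. -/
def rTensor (h : X →ₗ[R] Y) : tensor X V ⟶ tensor Y V :=
  ⟨h.rTensor V.carrier, isRightColinear_rTensor h⟩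

variable (X) in
/-- The morphism `id ⊗ f : X ⊗ V → X ⊗ W`. -/
def lTensor (f : V ⟶ W) : tensor X V ⟶ tensor X W := ⟨f.1.lTensor X, IsRightColinear.lTensor f.2⟩

theorem tmulHom_rTensor (h : X →ₗ[R] Y) (x : X) : tmulHom V x ≫ rTensor V h = tmulHom V (h x) :=
  hom_ext fun _ => rfl

theorem tmulHom_lTensor (f : V ⟶ W) (x : X) : tmulHom V x ≫ lTensor X f = f ≫ tmulHom W x :=
  hom_ext fun _ => rfl

theorem rTensor_id : rTensor V (LinearMap.id : X →ₗ[R] X) = 𝟙 _ :=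
  Subtype.ext (LinearMap.rTensor_id _ _)

theorem rTensor_comp {Z : Type u} [AddCommGroup Z] [Module R Z] (k : Y →ₗ[R] Z) (h : X →ₗ[R] Y) :
    rTensor V (k ∘ₗ h) = rTensor V h ≫ rTensor V k :=
  Subtype.ext (LinearMap.rTensor_comp _ _ _)

theorem lTensor_comp {Z : RightComodCat R C} (f : V ⟶ W) (g : W ⟶ Z) :
    lTensor X (f ≫ g) = lTensor X f ≫ lTensor X g :=
  Subtype.ext (LinearMap.lTensor_comp _ _ _)

variable (X Y V) in
/-- The associativity isomorphism `X ⊗ (Y ⊗ V) → (X ⊗ Y) ⊗ V`. -/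
def assocInv : tensor X (tensor Y V) ⟶ tensor (X ⊗[R] Y) V :=
  ⟨(TensorProduct.assoc R X Y V.carrier).symm.toLinearMap, isRightColinear_assoc.symm⟩

theorem tmulHom_assocInv (x : X) :
    tmulHom (tensor Y V) x ≫ assocInv X Y V = rTensor V (TensorProduct.mk R X Y x) :=
  tensor_hom_ext fun y => hom_ext fun v => TensorProduct.assoc_symm_tmul x y v

variable (V) in
/-- The coaction of `V` as a morphism `V → V ⊗ C`. -/
def coactHom : V ⟶ tensor V.carrier (reg R C) := ⟨rcoact R C V.carrier, isRightColinear_rcoact⟩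

theorem coactHom_naturality (f : V ⟶ W) :
    f ≫ coactHom W = coactHom V ≫ rTensor (reg R C) f.1 :=
  Subtype.ext f.2

variable (V) in
theorem coactHom_rTensor_rcoact :
    coactHom V ≫ rTensor (reg R C) (rcoact R C V.carrier) =
      coactHom V ≫ lTensor V.carrier (coactHom (reg R C)) ≫ assocInv V.carrier C (reg R C) :=
  hom_ext fun v => (LinearEquiv.eq_symm_apply (TensorProduct.assoc R V.carrier C C)).2 <|
    LinearMap.congr_fun RightComodule.coassoc v

variable (V) in
theorem rTensor_rcoact_injective : Function.Injective ((rcoact R C V.carrier).rTensor C) := by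
  refine Function.HasLeftInverse.injective ⟨((TensorProduct.rid R V.carrier).toLinearMap ∘ₗ
    (Coalgebra.counit (R := R) (A := C)).lTensor V.carrier).rTensor C, fun t => ?_⟩
  rw [← LinearMap.comp_apply, ← LinearMap.rTensor_comp, LinearMap.comp_assoc,
    RightComodule.counit_coact, LinearMap.rTensor_id, LinearMap.id_apply]

theorem exists_comp_coactHom_eq (k : W ⟶ tensor V.carrier (reg R C))
    (hk : k ≫ rTensor (reg R C) (rcoact R C V.carrier) =
      k ≫ lTensor V.carrier (coactHom (reg R C)) ≫ assocInv V.carrier C (reg R C)) :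
    ∃ l : W ⟶ V, l ≫ coactHom V = k := by
  have mem_cotensor (w : W.carrier) : k.1 w ∈ Cotensor R C V.carrier C :=
    mem_cotensor_iff.2 ((LinearEquiv.eq_symm_apply _).1 (congr_hom hk w))
  let k' := k.1.codRestrict _ mem_cotensor
  let l := (Cotensor.rightUnit R C V.carrier).symm.toLinearMap ∘ₗ k'
  have hl : rcoact R C V.carrier ∘ₗ l = k.1 := LinearMap.ext fun w =>
    congrArg Subtype.val ((Cotensor.rightUnit R C V.carrier).apply_symm_apply (k' w))
  exact ⟨⟨l, isRightColinear_rcoact.of_comp (rTensor_rcoact_injective V) (hl ▸ k.2)⟩,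
    Subtype.ext hl⟩

theorem mono_of_injective {f : V ⟶ W} (hf : Function.Injective f.1) : Mono f where
  right_cancellation _ _ h := hom_ext fun z => hf (congr_hom h z)

instance : Mono (coactHom V) := mono_of_injective rcoact_injective

variable (V) in
/-- A comodule `V` is the equalizer of the two maps `V ⊗ C → V ⊗ C ⊗ C`. -/
noncomputable def isLimitForkCoactHom :
    Limits.IsLimit (Limits.Fork.ofι (coactHom V) (coactHom_rTensor_rcoact V)) :=
  Limits.Fork.IsLimit.mk' _ fun s =>
    have h := exists_comp_coactHom_eq s.ι s.condition
    ⟨h.choose, h.choose_spec, fun hm => (cancel_mono (coactHom V)).1 (hm.trans h.choose_spec.symm)⟩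

theorem rcoact_mem_range_rTensor_ker [Module.Flat R C] (f : V ⟶ W) (v : LinearMap.ker f.1) :
    rcoact R C V.carrier v ∈ LinearMap.range ((LinearMap.ker f.1).subtype.rTensor C) := by
  refine (Module.Flat.rTensor_exact C (LinearMap.exact_subtype_ker_map f.1) _).1 ?_
  have colinear : rcoact R C W.carrier (f.1 v) = f.1.rTensor C (rcoact R C V.carrier v) :=
    LinearMap.congr_fun f.2 v.1
  rw [← colinear, LinearMap.mem_ker.1 v.2, map_zero]

theorem injective_of_mono [Module.Flat R C] (f : V ⟶ W) [Mono f] : Function.Injective f.1 := by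
  let K := LinearMap.ker f.1
  let : RightComodule R C K := subRight C K (rcoact_mem_range_rTensor_ker f)
  let i : (⟨K⟩ : RightComodCat R C) ⟶ V :=
    ⟨K.subtype, subRightCoact_spec C K (rcoact_mem_range_rTensor_ker f)⟩
  have i_comp : i ≫ f = 0 ≫ f := hom_ext fun v => by
    rw [Limits.zero_comp]
    exact v.2
  have i_eq_zero : i = 0 := (cancel_mono f).1 i_comp
  exact LinearMap.ker_eq_bot.1 <| LinearMap.ker_eq_bot'.2 fun v hv => congr_hom i_eq_zero ⟨v, hv⟩

theorem map_injective_of_injective {D : Type u} [AddCommGroup D] [Module R D] [Coalgebra R D]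
    [Module.Flat R D] (F : RightComodCat R C ⥤ RightComodCat R D) [F.PreservesMonomorphisms]
    {f : V ⟶ W} (hf : Function.Injective f.1) : Function.Injective (F.map f).1 :=
  have := mono_of_injective hf
  injective_of_mono (F.map f)

theorem bijective_of_isIso (f : V ⟶ W) [IsIso f] : Function.Bijective f.1 :=
  Function.bijective_iff_has_inverse.2
    ⟨(inv f).1, congr_hom (IsIso.hom_inv_id f), congr_hom (IsIso.inv_hom_id f)⟩

end RightComodCat

/-! ### Functors preserving tensor products with modules -/

open RightComodCat

/-- The bijection `Hom(F(V), Z) ≃ Hom(V, G(Z))` of an adjunction, as a linear equivalence. -/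
def homLinearEquiv (R : Type*) [Ring R] {A B : Type*} [Category A] [Category B] [Preadditive A]
    [Preadditive B] [Linear R A] [Linear R B] {F : A ⥤ B} [F.Additive] [F.Linear R] {G : B ⥤ A}
    (adj : F ⊣ G) (V : A) (Z : B) : (F.obj V ⟶ Z) ≃ₗ[R] (V ⟶ G.obj Z) :=
  LinearEquiv.symm
    { (adj.homEquiv V Z).symm with
      map_add' := fun f g => by simp [Adjunction.homEquiv_counit]
      map_smul' := fun r f => by simp [Adjunction.homEquiv_counit] }

theorem map_tmulHom_hom_ext {R : Type u} [CommRing R] {C : Type u} [AddCommGroup C] [Module R C]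
    [Coalgebra R C] {B : Type*} [Category B] {F : RightComodCat R C ⥤ B}
    {G : B ⥤ RightComodCat R C} (adj : F ⊣ G) {X : Type u} [AddCommGroup X] [Module R X]
    {V : RightComodCat R C} {Z : B} {f g : F.obj (tensor X V) ⟶ Z}
    (h : ∀ x : X, F.map (tmulHom V x) ≫ f = F.map (tmulHom V x) ≫ g) : f = g := by
  refine (adj.homEquiv _ _).injective (tensor_hom_ext fun x => ?_)
  rw [← Adjunction.homEquiv_naturality_left, h, Adjunction.homEquiv_naturality_left]

section TensorComparison

variable {R : Type u} [CommRing R] {C : Type u} [AddCommGroup C] [Module R C] [Coalgebra R C]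
  {D : Type u} [AddCommGroup D] [Module R D] [Coalgebra R D]
  (F : RightComodCat R C ⥤ RightComodCat R D) [F.Additive] [F.Linear R]
  (X : Type u) [AddCommGroup X] [Module R X] {Y : Type u} [AddCommGroup Y] [Module R Y]
  (V : RightComodCat R C) {W : RightComodCat R C}

/-- The canonical morphism `X ⊗ F(V) → F(X ⊗ V)`. -/
def tensorComparison : tensor X (F.obj V) ⟶ F.obj (tensor X V) :=
  tensorLift (F.mapLinearMap R ∘ₗ tmulHom V)

variable {X}

theorem tmulHom_tensorComparison (x : X) :
    tmulHom (F.obj V) x ≫ tensorComparison F X V = F.map (tmulHom V x) :=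
  tmulHom_tensorLift _ x

variable {V}

theorem rTensor_tensorComparison (h : X →ₗ[R] Y) :
    rTensor (F.obj V) h ≫ tensorComparison F Y V =
      tensorComparison F X V ≫ F.map (rTensor V h) := by
  refine tensor_hom_ext fun x => ?_
  rw [reassoc_of% tmulHom_rTensor h x, tmulHom_tensorComparison,
    reassoc_of% tmulHom_tensorComparison F V x, ← F.map_comp, tmulHom_rTensor]

theorem lTensor_tensorComparison (f : V ⟶ W) :
    lTensor X (F.map f) ≫ tensorComparison F X W =
      tensorComparison F X V ≫ F.map (lTensor X f) := by
  refine tensor_hom_ext fun x => ?_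
  rw [reassoc_of% tmulHom_lTensor (F.map f) x, tmulHom_tensorComparison,
    reassoc_of% tmulHom_tensorComparison F V x, ← F.map_comp, ← F.map_comp, tmulHom_lTensor]

theorem lTensor_tensorComparison_tensorComparison :
    lTensor X (tensorComparison F Y V) ≫ tensorComparison F X (tensor Y V) ≫
        F.map (assocInv X Y V) =
      assocInv X Y (F.obj V) ≫ tensorComparison F (X ⊗[R] Y) V := by
  refine tensor_hom_ext fun x => ?_
  rw [reassoc_of% tmulHom_lTensor (tensorComparison F Y V) x,
    reassoc_of% tmulHom_tensorComparison F (tensor Y V) x, ← F.map_comp, tmulHom_assocInv,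
    reassoc_of% tmulHom_assocInv (Y := Y) (V := F.obj V) x, rTensor_tensorComparison]

/-- A linear functor preserves tensor products with modules if all comparison morphisms
`X ⊗ F(V) → F(X ⊗ V)` are isomorphisms. -/
class PreservesTensors : Prop where
  isIso_tensorComparison (X : Type u) [AddCommGroup X] [Module R X] (V : RightComodCat R C) :
    IsIso (tensorComparison F X V)

attribute [instance] PreservesTensors.isIso_tensorComparison

/- Both sides represent `Z ↦ Hom(X, Hom(F(V), Z)) = Hom(X, Hom(V, G(Z)))` for `F` left adjoint
to `G`. -/
instance [F.IsLeftAdjoint] : PreservesTensors F where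
  isIso_tensorComparison X _ _ V := by
    let adj := Adjunction.ofIsLeftAdjoint F
    let E := homLinearEquiv R adj V (tensor X (F.obj V))
    let q := tensorLift (E.toLinearMap ∘ₗ tmulHom (F.obj V))
    let inverse := (adj.homEquiv _ _).symm q
    have map_tmulHom_inverse (x : X) : F.map (tmulHom V x) ≫ inverse = tmulHom (F.obj V) x := by
      rw [← Adjunction.homEquiv_naturality_left_symm, tmulHom_tensorLift]
      exact E.symm_apply_apply _
    refine ⟨inverse, tensor_hom_ext fun x => ?_, map_tmulHom_hom_ext adj fun x => ?_⟩
    · rw [reassoc_of% tmulHom_tensorComparison F V x, map_tmulHom_inverse, Category.comp_id]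
    · rw [reassoc_of% map_tmulHom_inverse x, tmulHom_tensorComparison, Category.comp_id]

end TensorComparison

/-! ### The Eilenberg–Watts bicomodule of a linear functor -/

section EilenbergWatts

variable {R : Type u} [CommRing R] {C : Type u} [AddCommGroup C] [Module R C] [Coalgebra R C]
  {D : Type u} [AddCommGroup D] [Module R D] [Coalgebra R D]
  (F : RightComodCat R C ⥤ RightComodCat R D) [F.Additive] [F.Linear R] [PreservesTensors F]

/-- The morphism `F(V) → V ⊗ F(C)` induced by the coaction of `V`. For `V = C` it is the left
coaction of `F(C)`. -/
noncomputable def coactObj (V : RightComodCat R C) :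
    F.obj V ⟶ tensor V.carrier (F.obj (reg R C)) :=
  F.map (coactHom V) ≫ inv (tensorComparison F V.carrier (reg R C))

theorem coactObj_tensorComparison (V : RightComodCat R C) :
    coactObj F V ≫ tensorComparison F V.carrier (reg R C) = F.map (coactHom V) := by
  rw [coactObj, Category.assoc, IsIso.inv_hom_id, Category.comp_id]

variable {V W : RightComodCat R C}

theorem coactObj_naturality (f : V ⟶ W) :
    F.map f ≫ coactObj F W = coactObj F V ≫ rTensor (F.obj (reg R C)) f.1 := by
  rw [← cancel_mono (tensorComparison F W.carrier (reg R C)), Category.assoc, Category.assoc,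
    coactObj_tensorComparison, rTensor_tensorComparison,
    reassoc_of% coactObj_tensorComparison F V, ← F.map_comp, ← F.map_comp, coactHom_naturality]

theorem tensorComparison_coactObj {X : Type u} [AddCommGroup X] [Module R X] :
    tensorComparison F X V ≫ coactObj F (tensor X V) =
      lTensor X (coactObj F V) ≫ assocInv X V.carrier (F.obj (reg R C)) := by
  refine tensor_hom_ext fun x => ?_
  rw [reassoc_of% tmulHom_tensorComparison F V x, coactObj_naturality,
    reassoc_of% tmulHom_lTensor (coactObj F V) x, tmulHom_assocInv]
  rfl

theorem coactObj_rTensor_rcoact :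
    coactObj F V ≫ rTensor (F.obj (reg R C)) (rcoact R C V.carrier) =
      coactObj F V ≫ lTensor V.carrier (coactObj F (reg R C)) ≫
        assocInv V.carrier C (F.obj (reg R C)) := by
  rw [← tensorComparison_coactObj, reassoc_of% coactObj_tensorComparison F V]
  exact (coactObj_naturality F (coactHom V)).symm

theorem coactObj_rTensor_rcoact_apply (t : (F.obj V).carrier) :
    TensorProduct.assoc R V.carrier C (F.obj (reg R C)).carrier
        ((rcoact R C V.carrier).rTensor (F.obj (reg R C)).carrier ((coactObj F V).1 t)) =
      (coactObj F (reg R C)).1.lTensor V.carrier ((coactObj F V).1 t) := by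
  rw [← LinearEquiv.eq_symm_apply]
  exact congr_hom (coactObj_rTensor_rcoact F (V := V)) t

theorem coactObj_rTensor_counit :
    coactObj F (reg R C) ≫ rTensor (F.obj (reg R C)) (Coalgebra.counit (R := R) (A := C)) =
      tmulHom (F.obj (reg R C)) (1 : R) := by
  have coactHom_rTensor_counit :
      coactHom (reg R C) ≫ rTensor (reg R C) (Coalgebra.counit (R := R) (A := C)) =
        tmulHom (reg R C) (1 : R) :=
    hom_ext fun c => Coalgebra.rTensor_counit_comul c
  rw [← cancel_mono (tensorComparison F R (reg R C)), Category.assoc, rTensor_tensorComparison,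
    reassoc_of% coactObj_tensorComparison F (reg R C), ← F.map_comp, coactHom_rTensor_counit,
    tmulHom_tensorComparison]

noncomputable instance : LeftComodule R C (F.obj (reg R C)).carrier where
  coact := (coactObj F (reg R C)).1
  coassoc := LinearMap.ext fun t => coactObj_rTensor_rcoact_apply F (V := reg R C) t
  counit_coact := LinearMap.ext fun t =>
    (congrArg (TensorProduct.lid R _) (congr_hom (coactObj_rTensor_counit F) t)).trans
      ((TensorProduct.lid_tmul _ _).trans (one_smul _ _))

instance : IsBicomodule R C D (F.obj (reg R C)).carrier where
  comm := by
    refine LinearMap.ext fun t => ?_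
    let N := (F.obj (reg R C)).carrier
    have colinear : (TensorProduct.assoc R C N D).symm
        ((rcoact R D N).lTensor C (lcoact R C N t)) =
          (lcoact R C N).rTensor D (rcoact R D N t) :=
      LinearMap.congr_fun (coactObj F (reg R C)).2 t
    exact ((LinearEquiv.symm_apply_eq _).1 colinear).symm

variable (V) in
/-- The canonical map `F(V) → V □_C F(C)`. -/
noncomputable def toCotensor :
    (F.obj V).carrier →ₗ[R] Cotensor R C V.carrier (F.obj (reg R C)).carrier :=
  (coactObj F V).1.codRestrict _ fun t => mem_cotensor_iff.2 (coactObj_rTensor_rcoact_apply F t)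

theorem subtype_comp_toCotensor :
    (Cotensor R C V.carrier (F.obj (reg R C)).carrier).subtype ∘ₗ toCotensor F V =
      (coactObj F V).1 := rfl

theorem exists_comp_coactObj_eq [Limits.PreservesLimitsOfShape Limits.WalkingParallelPair F]
    {Z : RightComodCat R D} (i : Z ⟶ tensor V.carrier (F.obj (reg R C)))
    (hi : i ≫ rTensor (F.obj (reg R C)) (rcoact R C V.carrier) =
      i ≫ lTensor V.carrier (coactObj F (reg R C)) ≫ assocInv V.carrier C (F.obj (reg R C))) :
    ∃ l : Z ⟶ F.obj V, l ≫ coactObj F V = i := by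
  have equalizes :
      (i ≫ tensorComparison F V.carrier (reg R C)) ≫
          F.map (rTensor (reg R C) (rcoact R C V.carrier)) =
        (i ≫ tensorComparison F V.carrier (reg R C)) ≫
          F.map (lTensor V.carrier (coactHom (reg R C)) ≫ assocInv V.carrier C (reg R C)) := by
    rw [Category.assoc, ← rTensor_tensorComparison, reassoc_of% hi,
      ← lTensor_tensorComparison_tensorComparison, F.map_comp, Category.assoc,
      ← reassoc_of% lTensor_tensorComparison F (X := V.carrier) (coactHom (reg R C)),
      ← coactObj_tensorComparison, lTensor_comp, Category.assoc]
  obtain ⟨l, hl⟩ := Limits.Fork.IsLimit.lift'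
    (Limits.isLimitForkMapOfIsLimit F _ (isLimitForkCoactHom V)) _ equalizes
  refine ⟨l, (cancel_mono (tensorComparison F V.carrier (reg R C))).1 ?_⟩
  rw [Category.assoc, coactObj_tensorComparison]
  exact hl

variable [Module.Flat R D]

theorem isRightColinear_toCotensor : IsRightColinear R D (toCotensor F V) :=
  cotensor_subtype_rightColinear.of_comp (rTensor_subtype_injective D _) (coactObj F V).2

variable [F.PreservesMonomorphisms]

theorem coactObj_injective : Function.Injective (coactObj F V).1 := by
  have h := map_injective_of_injective F (f := coactHom V) rcoact_injective
  rw [← coactObj_tensorComparison] at h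
  exact Function.Injective.of_comp (f := (tensorComparison F V.carrier (reg R C)).1) h

instance [Module.Flat R C] : Module.Flat R (F.obj (reg R C)).carrier := by
  refine Module.Flat.iff_rTensor_preserves_injective_linearMap.2 fun X Y _ _ _ _ h hh => ?_
  have map_rTensor_injective : Function.Injective (F.map (rTensor (reg R C) h)).1 :=
    map_injective_of_injective F (Module.Flat.rTensor_preserves_injective_linearMap h hh)
  have comp_injective :
      Function.Injective (tensorComparison F X (reg R C) ≫ F.map (rTensor (reg R C) h)).1 :=
    map_rTensor_injective.comp (bijective_of_isIso (tensorComparison F X (reg R C))).1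
  rw [← rTensor_tensorComparison] at comp_injective
  exact Function.Injective.of_comp (f := (tensorComparison F Y (reg R C)).1) comp_injective

variable [Limits.PreservesLimitsOfShape Limits.WalkingParallelPair F]

theorem toCotensor_bijective : Function.Bijective (toCotensor F V) := by
  refine ⟨fun a b h => coactObj_injective F (congrArg Subtype.val h), fun t => ?_⟩
  let N := F.obj (reg R C)
  let i : (⟨Cotensor R C V.carrier N.carrier⟩ : RightComodCat R D) ⟶ tensor V.carrier N :=
    ⟨(Cotensor R C V.carrier N.carrier).subtype, cotensor_subtype_rightColinear⟩
  have equalizes : i ≫ rTensor N (rcoact R C V.carrier) =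
      i ≫ lTensor V.carrier (coactObj F (reg R C)) ≫ assocInv V.carrier C N :=
    hom_ext fun t => (LinearEquiv.eq_symm_apply (TensorProduct.assoc R V.carrier C N.carrier)).2 <|
      mem_cotensor_iff.1 t.2
  obtain ⟨l, hl⟩ := exists_comp_coactObj_eq F i equalizes
  exact ⟨l.1 t, Subtype.ext (congr_hom hl t)⟩

theorem isPure_cotensor : IsPure (Cotensor R C V.carrier (F.obj (reg R C)).carrier) := by
  intro X _ _
  rw [← LinearMap.lTensor_inj_iff_rTensor_inj]
  have comp_injective : Function.Injective (tensorComparison F X V ≫ coactObj F (tensor X V)).1 :=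
    (coactObj_injective F).comp (bijective_of_isIso (tensorComparison F X V)).1
  rw [tensorComparison_coactObj] at comp_injective
  have lTensor_injective : Function.Injective ((coactObj F V).1.lTensor X) :=
    Function.Injective.of_comp (f := (assocInv X V.carrier (F.obj (reg R C))).1) comp_injective
  rw [← subtype_comp_toCotensor, LinearMap.lTensor_comp, LinearMap.coe_comp] at lTensor_injective
  exact lTensor_injective.of_comp_right
    ((LinearEquiv.ofBijective _ (toCotensor_bijective F (V := V))).lTensor X).surjective

end EilenbergWatts

/-! ### The context of a linear equivalence -/

section EquivalenceContext

variable {R : Type u} [CommRing R] {C : Type u} [AddCommGroup C] [Module R C] [Coalgebra R C]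
  {D : Type u} [AddCommGroup D] [Module R D] [Coalgebra R D]
  {F : RightComodCat R C ⥤ RightComodCat R D} {G : RightComodCat R D ⥤ RightComodCat R C}
  (η : 𝟭 _ ⟶ F ⋙ G) (ι : 𝟭 _ ⟶ G ⋙ F)

/-- The component `W → F(G(W))` of a natural transformation, typed without `𝟭` and `⋙` so that the
lemmas on `F` and `G` rewrite inside composites with it. -/
def unitApp (W : RightComodCat R D) : W ⟶ F.obj (G.obj W) := ι.app W

theorem unitApp_naturality {V W : RightComodCat R D} (f : V ⟶ W) :
    f ≫ unitApp ι W = unitApp ι V ≫ F.map (G.map f) :=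
  ι.naturality f

instance [IsIso ι] (W : RightComodCat R D) : IsIso (unitApp ι W) :=
  inferInstanceAs (IsIso (ι.app W))

section Unit

variable [F.Additive] [F.Linear R] [PreservesTensors F]

/-- The morphism `D → F(G(D)) → G(D) ⊗ F(C)`. -/
noncomputable def unitCoact : reg R D ⟶ tensor (G.obj (reg R D)).carrier (F.obj (reg R C)) :=
  unitApp ι (reg R D) ≫ coactObj F (G.obj (reg R D))

/-- The bicomodule morphism `D → G(D) □_C F(C)`. -/
noncomputable def unitCotensor :
    D →ₗ[R] Cotensor R C (G.obj (reg R D)).carrier (F.obj (reg R C)).carrier :=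
  toCotensor F (G.obj (reg R D)) ∘ₗ (unitApp ι (reg R D)).1

variable [Module.Flat R D]

theorem isRightColinear_unitCotensor : IsRightColinear R D (unitCotensor ι) :=
  (isRightColinear_toCotensor F).comp (unitApp ι (reg R D)).2

variable [F.PreservesMonomorphisms] [Limits.PreservesLimitsOfShape Limits.WalkingParallelPair F]

theorem unitCotensor_bijective [IsIso ι] : Function.Bijective (unitCotensor ι) :=
  (toCotensor_bijective F).comp (bijective_of_isIso (unitApp ι (reg R D)))

end Unit

variable [F.Additive] [F.Linear R] [G.Additive] [G.Linear R]

theorem lTensor_unitApp_tensorComparison {X : Type u} [AddCommGroup X] [Module R X]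
    (W : RightComodCat R D) :
    lTensor X (unitApp ι W) ≫ tensorComparison F X (G.obj W) ≫ F.map (tensorComparison G X W) =
      unitApp ι (tensor X W) := by
  refine tensor_hom_ext fun x => ?_
  rw [reassoc_of% tmulHom_lTensor (unitApp ι W) x,
    reassoc_of% tmulHom_tensorComparison F (G.obj W) x, ← F.map_comp, tmulHom_tensorComparison,
    unitApp_naturality]

variable [PreservesTensors G]

theorem unitApp_map_coactObj :
    unitApp ι (reg R D) ≫ F.map (coactObj G (reg R D)) =
      coactHom (reg R D) ≫ lTensor D (unitApp ι (reg R D)) ≫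
        tensorComparison F D (G.obj (reg R D)) := by
  rw [← cancel_mono (F.map (tensorComparison G D (reg R D)))]
  simp only [Category.assoc]
  rw [lTensor_unitApp_tensorComparison, ← F.map_comp, unitApp_naturality,
    coactObj_tensorComparison]

theorem lTensor_unitCoact_assocInv_rTensor_tensorComparison (X : Type u) [AddCommGroup X]
    [Module R X] :
    lTensor X (unitCoact η) ≫ assocInv X (F.obj (reg R C)).carrier (G.obj (reg R D)) ≫
        rTensor (G.obj (reg R D)) (tensorComparison F X (reg R C)).1 =
      unitApp η (tensor X (reg R C)) ≫ coactObj G (F.obj (tensor X (reg R C))) := by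
  refine tensor_hom_ext fun x => ?_
  have tensorComparison_comp_mk : (tensorComparison F X (reg R C)).1 ∘ₗ
      TensorProduct.mk R X (F.obj (reg R C)).carrier x = (F.map (tmulHom (reg R C) x)).1 :=
    congrArg Subtype.val (tmulHom_tensorComparison F (reg R C) x)
  rw [reassoc_of% tmulHom_lTensor (unitCoact η) x,
    reassoc_of% tmulHom_assocInv (V := G.obj (reg R D)) x, ← rTensor_comp,
    tensorComparison_comp_mk, unitCoact, Category.assoc, ← coactObj_naturality,
    reassoc_of% unitApp_naturality η (tmulHom (reg R C) x)]

variable [PreservesTensors F]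

theorem unitCoact_rTensor_coactObj :
    unitCoact ι ≫ rTensor (F.obj (reg R C)) (coactObj G (reg R D)).1 =
      coactHom (reg R D) ≫ lTensor D (unitCoact ι) ≫
        assocInv D (G.obj (reg R D)).carrier (F.obj (reg R C)) := by
  rw [unitCoact, Category.assoc, ← coactObj_naturality,
    reassoc_of% unitApp_map_coactObj (F := F) (G := G) ι, tensorComparison_coactObj, lTensor_comp,
    Category.assoc]

theorem isLeftColinear_unitCoact : IsLeftColinear R D (unitCoact ι).1 :=
  LinearMap.ext fun d => (LinearEquiv.eq_symm_apply (TensorProduct.assoc R D _ _)).1 <|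
    congr_hom (unitCoact_rTensor_coactObj ι) d

theorem coactHom_lTensor_unitCoact (V : RightComodCat R C) :
    coactHom V ≫ lTensor V.carrier (unitCoact η) ≫
        assocInv V.carrier (F.obj (reg R C)).carrier (G.obj (reg R D)) =
      unitApp η V ≫ coactObj G (F.obj V) ≫ rTensor (G.obj (reg R D)) (coactObj F V).1 := by
  let T := tensorComparison F V.carrier (reg R C)
  have rTensor_hom_inv : rTensor (G.obj (reg R D)) T.1 ≫ rTensor (G.obj (reg R D)) (inv T).1 =
      𝟙 _ := by
    rw [← rTensor_comp, ← rTensor_id]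
    exact congrArg (rTensor (G.obj (reg R D))) (congrArg Subtype.val (IsIso.hom_inv_id T))
  have coactObj_eq : (coactObj F V).1 = (inv T).1 ∘ₗ (F.map (coactHom V)).1 := rfl
  rw [coactObj_eq, rTensor_comp, ← reassoc_of% coactObj_naturality G (F.map (coactHom V)),
    ← reassoc_of% unitApp_naturality η (coactHom V),
    ← reassoc_of% lTensor_unitCoact_assocInv_rTensor_tensorComparison (F := F) (G := G) η,
    rTensor_hom_inv, Category.comp_id]

theorem lTensor_unitCoact_rcoact
    (h : unitApp η (G.obj (reg R D)) = G.map (unitApp ι (reg R D)))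
    (m : (G.obj (reg R D)).carrier) :
    (unitCoact η).1.lTensor _ (rcoact R C _ m) =
      TensorProduct.assoc R _ _ _ ((unitCoact ι).1.rTensor _ (lcoact R D _ m)) := by
  let M := G.obj (reg R D)
  have colinear : coactHom M ≫ lTensor M.carrier (unitCoact η) ≫ assocInv _ _ M =
      coactObj G (reg R D) ≫ rTensor M (unitCoact ι).1 := by
    rw [coactHom_lTensor_unitCoact, h, reassoc_of% coactObj_naturality G (unitApp ι (reg R D)),
      ← rTensor_comp]
    rfl
  exact (LinearEquiv.symm_apply_eq _).1 (congr_hom colinear m)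

variable [Module.Flat R D]

theorem isLeftColinear_unitCotensor : IsLeftColinear R D (unitCotensor ι) :=
  cotensor_subtype_leftColinear.of_comp (lTensor_subtype_injective D _) (isLeftColinear_unitCoact ι)

variable [Module.Flat R C] [G.PreservesMonomorphisms]

theorem mapRight_unitCotensor
    (h : unitApp η (G.obj (reg R D)) = G.map (unitApp ι (reg R D)))
    (m : (G.obj (reg R D)).carrier) :
    Cotensor.mapRight (G.obj (reg R D)).carrier (unitCotensor η) (isLeftColinear_unitCotensor η)
        (Cotensor.rightUnit R C _ m) =
      Cotensor.assoc R C D _ _ _ (Cotensor.mapLeft (G.obj (reg R D)).carrier (unitCotensor ι)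
        (isRightColinear_unitCotensor ι) (Cotensor.leftUnit R D _ m)) := by
  let M := (G.obj (reg R D)).carrier
  let N := (F.obj (reg R C)).carrier
  refine Cotensor.inclRight_injective R C D M N M ?_
  rw [Cotensor.inclRight_assoc]
  have square := lTensor_unitCoact_rcoact η ι h m
  have unitCoact_η : (unitCoact η).1 = (Cotensor R D N M).subtype ∘ₗ unitCotensor η := rfl
  have unitCoact_ι : (unitCoact ι).1 = (Cotensor R C M N).subtype ∘ₗ unitCotensor ι := rfl
  rw [unitCoact_η, unitCoact_ι, LinearMap.lTensor_comp, LinearMap.rTensor_comp] at square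
  exact square

variable [F.PreservesMonomorphisms] [Limits.PreservesLimitsOfShape Limits.WalkingParallelPair F]
  [Limits.PreservesLimitsOfShape Limits.WalkingParallelPair G]

/-- The Morita–Takeuchi context with `M = G(D)` and `N = F(C)`, for functors `F` and `G` with
natural transformations satisfying the two triangle identities of inverse equivalences. -/
noncomputable def contextOfUnits
    (h : unitApp η (G.obj (reg R D)) = G.map (unitApp ι (reg R D)))
    (h' : unitApp ι (F.obj (reg R C)) = F.map (unitApp η (reg R C))) :
    MoritaTakeuchiContext R D C where
  M := (G.obj (reg R D)).carrier
  N := (F.obj (reg R C)).carrier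
  pureMN := isPure_cotensor F
  pureNM := isPure_cotensor G
  f := unitCotensor ι
  f_left := isLeftColinear_unitCotensor ι
  f_right := isRightColinear_unitCotensor ι
  g := unitCotensor η
  g_left := isLeftColinear_unitCotensor η
  g_right := isRightColinear_unitCotensor η
  diagramM := mapRight_unitCotensor η ι h
  diagramN := mapRight_unitCotensor ι η h'

end EquivalenceContext

theorem MoritaTakeuchiEquivalent.exists_isStrict {R : Type u} [CommRing R]
    {C : Type u} [AddCommGroup C] [Module R C] [Coalgebra R C] [Module.Flat R C]
    {D : Type u} [AddCommGroup D] [Module R D] [Coalgebra R D] [Module.Flat R D]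
    (h : MoritaTakeuchiEquivalent R C D) : ∃ K : MoritaTakeuchiContext R D C, K.IsStrict := by
  obtain ⟨e, _, _⟩ := h
  exact ⟨contextOfUnits e.unitIso.hom e.counitIso.inv (e.unit_app_inverse _)
    (e.counitInv_app_functor _), unitCotensor_bijective e.counitIso.inv,
    unitCotensor_bijective e.unitIso.hom⟩

end MoritaTakeuchi

theorem mainTheorem2 {R : Type u} [CommRing R]
    (C : Type u) [AddCommGroup C] [Module R C] [Coalgebra R C] [Module.Flat R C]
    (D : Type u) [AddCommGroup D] [Module R D] [Coalgebra R D] [Module.Flat R D] :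
    MoritaTakeuchi.MoritaTakeuchiEquivalent R C D ↔
      ∃ K : MoritaTakeuchi.MoritaTakeuchiContext R D C, K.IsStrict :=
  ⟨fun h => h.exists_isStrict, fun ⟨_, hK⟩ => hK.moritaTakeuchiEquivalent⟩
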